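/- Let $n$ objects with true scores $\beta^*\in\mathbb{R}^n$, $\sum_i\beta^*_i=0$, be compared in pairs by subjects $s=1,2,\dots$, and let $\sigma(t)=1/(1+e^{-t})$. Let $W^{(s)}_{ij}$ be the number of times subject $s$ prefers $i$ to $j$ (with $W^{(s)}_{ii}=0$), let $\mathbf V^{(s)}=\mathbf W^{(s)}+(\mathbf W^{(s)})^\top$ be the comparison matrix of subject $s$, and let $V^{(s)}=\sum_{i<j}V^{(s)}_{ij}$ be the number of comparisons made by $s$. Assume: - the subjects are independent, i.e. the random matrices $\mathbf W^{(1)},\mathbf W^{(2)},\dots$ are independent; - the $V^{(s)}$ are identically distributed with $0<\mathbb{E}[V^{(s)}]<\infty$ and $\mathrm{Var}[V^{(s)}]<\infty$; - there is a matrix $\mathbf P\in[0,1]^{n\times n}$ with $\mathbb{E}[\mathbf V^{(s)}\mid V^{(s)}]=V^{(s)}\mathbf P$ for all $s$; - the comparisons follow the Bradley–Terry model: given $\mathbf V^{(s)}$, the outcomes of the comparisons of subject $s$ are independent, and $i$ beats $j$ in each comparison of $i$ with $j$ with probability $\sigma(\beta^*_i-\beta^*_j)$. For $S$ subjects put $\mathbf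 W=\sum_{s\le S}\mathbf W^{(s)}$, $V=\sum_{s\le S}V^{(s)}$, $\ell(\beta;\mathbf W)=\sum_{i\ne j}W_{ij}\log\sigma(\beta_i-\beta_j)$, and let $H(\beta;\mathbf W)$ be the Hessian matrix of $\ell(\cdot\,;\mathbf W)$ at $\beta$. A maximum likelihood estimate (MLE) under the sum constraint is a maximizer of $\ell(\cdot\,;\mathbf W)$ on $\{\beta:\sum_i\beta_i=0\}$. Let $\mathcal I(\beta^*)$ be the Fisher information matrix of one comparison, $$\mathcal I(\beta^*)=\sum_{i\neq j}P_{ij}\,\sigma(\beta^*_i-\beta^*_j)\,g_{ij}g_{ij}^\top,\qquad g_{ij}=\nabla_\beta\log\sigma(\beta_i-\beta_j)\big|_{\beta=\beta^*},$$ and let $A^\dagger$ denote the Moore–Penrose pseudoinverse of $A$. Suppose that for at least one $S$ the MLE under the sum constraint exists and is unique with positive probability, and let $\hat\beta=\hat\beta(\mathbf W)$ be any function of $\mathbf W$ that equals the MLE whenever the MLE exists and is unique. Then, as $S\to\infty$, $V\to\infty$ almost surely and $$\sqrt{V}\,(\hat\beta-\beta^*)\xrightarrow{d}\mathcal N\bigl(0,\mathcal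 I^\dagger(\beta^*)\bigr).$$ Moreover, the asymptotic variance is consistently estimated by means of $-H^\dagger(\hat\beta;\mathbf W)$: each entry of $-V\,H^\dagger(\hat\beta;\mathbf W)$ converges in probability to the corresponding entry of $\mathcal I^\dagger(\beta^*)$. -/

import Mathlib

open MeasureTheory ProbabilityTheory Filter Topology

/-! ### Moore–Penrose pseudoinverse of a real square matrix -/

/-- `X` is the pseudoinverse of `A`: the four Penrose conditions. -/
structure IsPseudoinverse {n : ℕ} (A X : Matrix (Fin n) (Fin n) ℝ) : Prop where
  mul_mul_left : A * X * A = A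
  mul_mul_right : X * A * X = X
  symm_left : (A * X).transpose = A * X
  symm_right : (X * A).transpose = X * A

theorem exists_symm_isPseudoinverse {n : ℕ} (A : Matrix (Fin n) (Fin n) ℝ)
    (hA : A.IsHermitian) : ∃ X, IsPseudoinverse A X ∧ X.transpose = X := by
  have hs := hA.spectral_theorem
  set U : Matrix (Fin n) (Fin n) ℝ := (hA.eigenvectorUnitary : Matrix (Fin n) (Fin n) ℝ) with hU
  have hUU : U.transpose * U = 1 := by
    have := Unitary.coe_star_mul_self hA.eigenvectorUnitary
    simpa [Matrix.star_eq_conjTranspose] using this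
  set d : Fin n → ℝ := hA.eigenvalues
  have hA' : A = U * Matrix.diagonal d * U.transpose := by
    rw [hs, Unitary.conjStarAlgAut_apply]
    simp [Matrix.star_eq_conjTranspose, hU, d]
  have key : ∀ a b : Fin n → ℝ, (U * Matrix.diagonal a * U.transpose) *
      (U * Matrix.diagonal b * U.transpose) =
      U * Matrix.diagonal (fun i => a i * b i) * U.transpose := by
    intro a b
    calc _ = U * Matrix.diagonal a * (U.transpose * U) * Matrix.diagonal b * U.transpose := by
          simp only [Matrix.mul_assoc]
      _ = _ := by rw [hUU, Matrix.mul_one, Matrix.mul_assoc U, Matrix.diagonal_mul_diagonal]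
  have keyT : ∀ a : Fin n → ℝ, (U * Matrix.diagonal a * U.transpose).transpose =
      U * Matrix.diagonal a * U.transpose := by
    intro a
    simp [Matrix.transpose_mul, Matrix.mul_assoc]
  refine ⟨U * Matrix.diagonal (fun i => (d i)⁻¹) * U.transpose, ⟨?_, ?_, ?_, ?_⟩, keyT _⟩
  · rw [hA', key, key]; congr 3; funext i; by_cases h : d i = 0 <;> simp [h]
  · rw [hA', key, key]
    congr 3
    funext i
    by_cases h : d i = 0 <;> simp [h]
  · rw [hA', key, keyT]
  · rw [hA', key, keyT]

theorem exists_isPseudoinverse {n : ℕ} (A : Matrix (Fin n) (Fin n) ℝ) :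
    ∃ X, IsPseudoinverse A X := by
  obtain ⟨Y, hY, hYt⟩ := exists_symm_isPseudoinverse (A.transpose * A)
    (by simpa using Matrix.isHermitian_conjTranspose_mul_self A)
  have hz : A - A * (Y * (A.transpose * A)) = 0 := by
    rw [← Matrix.conjTranspose_mul_self_eq_zero]
    have h1 : A.transpose * (A - A * (Y * (A.transpose * A))) = 0 := by
      have := hY.mul_mul_left
      rw [Matrix.mul_sub, sub_eq_zero]
      simpa only [Matrix.mul_assoc] using this.symm
    have h2 : (A - A * (Y * (A.transpose * A))).conjTranspose =
        (1 - (Y * (A.transpose * A)).transpose) * A.transpose := by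
      simp [Matrix.transpose_sub, Matrix.transpose_mul, Matrix.sub_mul, Matrix.mul_assoc]
    rw [h2, Matrix.mul_assoc, h1, Matrix.mul_zero]
  have hz' : A * (Y * (A.transpose * A)) = A := (sub_eq_zero.mp hz).symm
  refine ⟨Y * A.transpose, ⟨?_, ?_, ?_, ?_⟩⟩
  · simpa only [Matrix.mul_assoc] using hz'
  · have := congrArg (· * A.transpose) hY.mul_mul_right
    simpa only [Matrix.mul_assoc] using this
  · simp [Matrix.transpose_mul, hYt, Matrix.mul_assoc]
  · simpa only [Matrix.mul_assoc] using hY.symm_right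

theorem IsPseudoinverse.unique {n : ℕ} {A X Y : Matrix (Fin n) (Fin n) ℝ}
    (hX : IsPseudoinverse A X) (hY : IsPseudoinverse A Y) : X = Y := by
  have h1 : A * X = A * Y := by
    calc A * X = (A * X).transpose := hX.symm_left.symm
      _ = (A * Y * (A * X)).transpose := by rw [← Matrix.mul_assoc, hY.mul_mul_left]
      _ = A * X * (A * Y) := by rw [Matrix.transpose_mul, hX.symm_left, hY.symm_left]
      _ = A * Y := by rw [← Matrix.mul_assoc, hX.mul_mul_left]
  have h2 : X * A = Y * A := by
    calc X * A = (X * A).transpose := hX.symm_right.symm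
      _ = (X * A * (Y * A)).transpose := by
          rw [Matrix.mul_assoc X A, ← Matrix.mul_assoc A Y A, hY.mul_mul_left]
      _ = Y * A * (X * A) := by rw [Matrix.transpose_mul, hX.symm_right, hY.symm_right]
      _ = Y * A := by rw [Matrix.mul_assoc Y A, ← Matrix.mul_assoc A X A, hX.mul_mul_left]
  calc X = X * A * X := hX.mul_mul_right.symm
    _ = Y * A * X := by rw [h2]
    _ = Y * (A * X) := Matrix.mul_assoc _ _ _
    _ = Y * (A * Y) := by rw [h1]
    _ = Y * A * Y := (Matrix.mul_assoc _ _ _).symm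
    _ = Y := hY.mul_mul_right

/-- The pseudoinverse `A†` (it exists and is unique for every `A`). -/
noncomputable def pseudoinverse {n : ℕ} (A : Matrix (Fin n) (Fin n) ℝ) :
    Matrix (Fin n) (Fin n) ℝ :=
  Classical.choose (exists_isPseudoinverse A)

/-! ### The Bradley–Terry model

`W i j` is the number of times that object `i` beats object `j`. -/

/-- The set of contingency matrices is countable and carries the discrete σ-algebra. -/
instance instMeasurableSpaceNatMatrix {n : ℕ} : MeasurableSpace (Matrix (Fin n) (Fin n) ℕ) := ⊤

/-- The comparison matrix `V = W + Wᵀ`. -/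
def comparisonMatrix {n : ℕ} (W : Matrix (Fin n) (Fin n) ℕ) : Matrix (Fin n) (Fin n) ℕ :=
  W + W.transpose

/-- The number of comparisons recorded in `W`; each unordered pair of objects is counted once. -/
def numComparisons {n : ℕ} (W : Matrix (Fin n) (Fin n) ℕ) : ℕ :=
  ∑ i, ∑ j ∈ Finset.Ioi i, comparisonMatrix W i j

/-- The log-likelihood of the single outcome "`i` beats `j`". -/
noncomputable def pairLogLik {n : ℕ} (i j : Fin n) (b : EuclideanSpace ℝ (Fin n)) : ℝ :=
  Real.log (Real.sigmoid (b i - b j))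

/-- The log-likelihood `ℓ(b; W)`, a sum over the ordered pairs of distinct objects. -/
noncomputable def logLik {n : ℕ} (W : Matrix (Fin n) (Fin n) ℕ)
    (b : EuclideanSpace ℝ (Fin n)) : ℝ :=
  ∑ i, ∑ j ∈ Finset.univ.erase i, (W i j : ℝ) * pairLogLik i j b

/-- The Hessian matrix `H(b; W)` of the log-likelihood. -/
noncomputable def hessian {n : ℕ} (W : Matrix (Fin n) (Fin n) ℕ)
    (b : EuclideanSpace ℝ (Fin n)) : Matrix (Fin n) (Fin n) ℝ :=
  Matrix.of fun k l =>
    fderiv ℝ (fun x => fderiv ℝ (logLik W) x (EuclideanSpace.single l 1)) b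
      (EuclideanSpace.single k 1)

/-- `b` is a maximum likelihood estimate under the sum constraint `∑ i, b i = 0`. -/
def IsSumMLE {n : ℕ} (W : Matrix (Fin n) (Fin n) ℕ) (b : EuclideanSpace ℝ (Fin n)) : Prop :=
  ∑ i, b i = 0 ∧ ∀ c : EuclideanSpace ℝ (Fin n), ∑ i, c i = 0 → logLik W c ≤ logLik W b

/-- The Fisher information of one comparison (the second-moment matrix of its score), when the
unordered pair `{i, j}` is compared with frequency `P i j` and the scores of the objects are `b`:
the outcome "`i` beats `j`" then has probability `P i j * σ(b i - b j)`. -/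
noncomputable def fisherInfo {n : ℕ} (P : Matrix (Fin n) (Fin n) ℝ)
    (b : EuclideanSpace ℝ (Fin n)) : Matrix (Fin n) (Fin n) ℝ :=
  Matrix.of fun k l =>
    ∑ i, ∑ j ∈ Finset.univ.erase i, P i j * Real.sigmoid (b i - b j) *
      (gradient (pairLogLik i j) b k * gradient (pairLogLik i j) b l)

/-- The conditional probability of the contingency matrix `w` given its comparison matrix, when
all comparisons are independent and `i` beats `j` with probability `σ(b i - b j)`. -/
noncomputable def outcomeProb {n : ℕ} (b : EuclideanSpace ℝ (Fin n))
    (w : Matrix (Fin n) (Fin n) ℕ) : ℝ :=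
  ∏ i, ∏ j ∈ Finset.Ioi i, ((comparisonMatrix w i j).choose (w i j) : ℝ) *
    Real.sigmoid (b i - b j) ^ w i j * Real.sigmoid (b j - b i) ^ w j i

/-- The data collection design: `W s` is the contingency matrix of subject `s`, `P` the matrix of
comparison frequencies and `b` the vector of true scores. -/
structure IsSurvey {n : ℕ} {Ω : Type*} [MeasurableSpace Ω] (μ : Measure Ω)
    (W : ℕ → Ω → Matrix (Fin n) (Fin n) ℕ) (P : Matrix (Fin n) (Fin n) ℝ)
    (b : EuclideanSpace ℝ (Fin n)) : Prop where
  measurable : ∀ s, Measurable (W s)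
  /-- No object is compared with itself. -/
  diag_eq_zero : ∀ s ω i, W s ω i i = 0
  /-- The subjects are independent. -/
  indep : iIndepFun W μ
  /-- The numbers of comparisons made by the subjects are identically distributed. -/
  identDistrib : ∀ s, IdentDistrib (fun ω => numComparisons (W s ω))
    (fun ω => numComparisons (W 0 ω)) μ μ
  /-- They have finite variance and positive mean. -/
  memLp : MemLp (fun ω => (numComparisons (W 0 ω) : ℝ)) 2 μ
  mean_pos : 0 < ∫ ω, (numComparisons (W 0 ω) : ℝ) ∂μ
  freq_mem : ∀ i j, P i j ∈ Set.Icc (0 : ℝ) 1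
  /-- The equality assumption: the conditional expectation of the comparison matrix of a subject,
  given the number of comparisons that the subject makes, is that number times `P`. -/
  condExp_eq : ∀ s i j,
    μ[fun ω => (comparisonMatrix (W s ω) i j : ℝ) |
        MeasurableSpace.comap (fun ω => numComparisons (W s ω)) inferInstance]
      =ᵐ[μ] fun ω => (numComparisons (W s ω) : ℝ) * P i j
  /-- Given the comparison matrix, the outcomes of the comparisons are independent, and they
  follow the Bradley–Terry model with scores `b`. -/
  outcome_law : ∀ s (w : Matrix (Fin n) (Fin n) ℕ),
    μ.real {ω | W s ω = w} =
      μ.real {ω | comparisonMatrix (W s ω) = comparisonMatrix w} * outcomeProb b w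

/-- The pooled contingency matrix of the first `S` subjects. -/
def pooled {n : ℕ} {Ω : Type*} (W : ℕ → Ω → Matrix (Fin n) (Fin n) ℕ) (S : ℕ) (ω : Ω) :
    Matrix (Fin n) (Fin n) ℕ :=
  ∑ s ∈ Finset.range S, W s ω

/-!
Minus the Hessian of the log-likelihood is the Laplacian of the comparison graph, with edge weights
`Vᵢⱼ σ(βᵢ - βⱼ) σ(βⱼ - βᵢ)`. Existence of a unique maximizer for some `S` forces the graph of `P`
to be connected, so once the frequencies `Vᵢⱼ/V` are close to `Pᵢⱼ` this Laplacian is uniformly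
definite on the sum-zero hyperplane. As the score at `β*` is `o(V)`, a maximizer exists near `β*`,
and it is unique. With difference quotients of `σ` in place of derivatives, the difference of the
scores at `β̂` and `β*` is again a Laplacian applied to `β̂ - β*`; inverting it writes
`V (β̂ - β*)` as a convergent random matrix applied to the score at `β*`. That score is a sum of
independent centred vectors with covariance `𝔼V⁽ˢ⁾ • I(β*)`, dominated by the identically
distributed `2 V⁽ˢ⁾` but not themselves identically distributed, and a central limit theorem for
such sums together with Slutsky's theorem gives the result.
-/

open scoped Matrix

/-! ### Pseudoinverses of symmetric matrices -/

theorem IsPseudoinverse.pseudoinverse_eq {n : ℕ} {A X : Matrix (Fin n) (Fin n) ℝ}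
    (h : IsPseudoinverse A X) : pseudoinverse A = X :=
  (Classical.choose_spec (exists_isPseudoinverse A)).unique h

theorem isPseudoinverse_pseudoinverse {n : ℕ} (A : Matrix (Fin n) (Fin n) ℝ) :
    IsPseudoinverse A (pseudoinverse A) :=
  Classical.choose_spec (exists_isPseudoinverse A)

theorem pseudoinverse_smul {n : ℕ} (c : ℝ) (A : Matrix (Fin n) (Fin n) ℝ) :
    pseudoinverse (c • A) = c⁻¹ • pseudoinverse A := by
  have h := isPseudoinverse_pseudoinverse A
  apply IsPseudoinverse.pseudoinverse_eq
  rcases eq_or_ne c 0 with rfl | hc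
  · constructor <;> simp
  have hl : (c • A) * (c⁻¹ • pseudoinverse A) = A * pseudoinverse A := by
    rw [Matrix.smul_mul, Matrix.mul_smul, smul_inv_smul₀ hc]
  have hr : (c⁻¹ • pseudoinverse A) * (c • A) = pseudoinverse A * A := by
    rw [Matrix.smul_mul, Matrix.mul_smul, inv_smul_smul₀ hc]
  constructor
  · rw [hl, Matrix.mul_smul, h.mul_mul_left]
  · rw [hr, Matrix.mul_smul, h.mul_mul_right]
  · rw [hl, h.symm_left]
  · rw [hr, h.symm_right]

theorem pseudoinverse_isSymm {n : ℕ} {A : Matrix (Fin n) (Fin n) ℝ} (hA : A.IsSymm) :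
    (pseudoinverse A).IsSymm := by
  obtain ⟨X, hX, hXt⟩ := exists_symm_isPseudoinverse A (by simpa [Matrix.IsHermitian] using hA.eq)
  rwa [hX.pseudoinverse_eq]

/-- If `Q` is the orthogonal projection onto the kernel of `A`, then `A†` inverts `A` after `A` has
been made invertible by adding `Q`. -/
theorem pseudoinverse_eq_inv_add_sub {n : ℕ} {A Q : Matrix (Fin n) (Fin n) ℝ} (hQ : Q.IsSymm)
    (hQQ : Q * Q = Q) (hAQ : A * Q = 0) (hQA : Q * A = 0) (hA : IsUnit (A + Q)) :
    pseudoinverse A = (A + Q)⁻¹ - Q := by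
  have hdet := (Matrix.isUnit_iff_isUnit_det _).1 hA
  have hQl : (A + Q)⁻¹ * Q = Q :=
    calc (A + Q)⁻¹ * Q = (A + Q)⁻¹ * ((A + Q) * Q) := by rw [add_mul, hAQ, hQQ, zero_add]
      _ = Q := Matrix.nonsing_inv_mul_cancel_left _ _ hdet
  have hQr : Q * (A + Q)⁻¹ = Q :=
    calc Q * (A + Q)⁻¹ = Q * (A + Q) * (A + Q)⁻¹ := by rw [mul_add, hQA, hQQ, zero_add]
      _ = Q := Matrix.mul_nonsing_inv_cancel_right _ _ hdet
  have hl : A * ((A + Q)⁻¹ - Q) = 1 - Q :=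
    calc A * ((A + Q)⁻¹ - Q) = (A + Q) * (A + Q)⁻¹ - Q * (A + Q)⁻¹ := by
          rw [mul_sub, hAQ, add_mul]; abel
      _ = 1 - Q := by rw [Matrix.mul_nonsing_inv _ hdet, hQr]
  have hr : ((A + Q)⁻¹ - Q) * A = 1 - Q :=
    calc ((A + Q)⁻¹ - Q) * A = (A + Q)⁻¹ * (A + Q) - (A + Q)⁻¹ * Q := by
          rw [sub_mul, hQA, mul_add]; abel
      _ = 1 - Q := by rw [Matrix.nonsing_inv_mul _ hdet, hQl]
  have hsymm : (1 - Q).transpose = 1 - Q := by rw [Matrix.transpose_sub, hQ, Matrix.transpose_one]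
  refine IsPseudoinverse.pseudoinverse_eq ⟨?_, ?_, by rw [hl, hsymm], by rw [hr, hsymm]⟩
  · rw [hl, sub_mul, one_mul, hQA, sub_zero]
  · rw [hr, sub_mul, one_mul, mul_sub, hQr, hQQ, sub_self, sub_zero]

/-- The pseudoinverse is discontinuous, but it is continuous along matrices with a common
kernel. -/
theorem tendsto_pseudoinverse {n : ℕ} {α : Type*} {l : Filter α}
    {M : α → Matrix (Fin n) (Fin n) ℝ} {A Q : Matrix (Fin n) (Fin n) ℝ} (hM : Tendsto M l (𝓝 A))
    (hQ : Q.IsSymm) (hQQ : Q * Q = Q) (hMQ : ∀ x, M x * Q = 0) (hQM : ∀ x, Q * M x = 0)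
    (hAQ : A * Q = 0) (hQA : Q * A = 0) (hA : IsUnit (A + Q)) :
    Tendsto (fun x => pseudoinverse (M x)) l (𝓝 (pseudoinverse A)) := by
  have hMQ' : Tendsto (fun x => M x + Q) l (𝓝 (A + Q)) := hM.add_const Q
  have hdet : (A + Q).det ≠ 0 := ((Matrix.isUnit_iff_isUnit_det _).1 hA).ne_zero
  have hunit : ∀ᶠ x in l, IsUnit (M x + Q) := by
    have hdetM : Tendsto (fun x => (M x + Q).det) l (𝓝 (A + Q).det) :=
      (continuous_id.matrix_det.tendsto (A + Q)).comp hMQ'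
    filter_upwards [hdetM.eventually_ne hdet] with x hx
    exact (Matrix.isUnit_iff_isUnit_det _).2 hx.isUnit
  have hinv : Tendsto (fun x => (M x + Q)⁻¹) l (𝓝 (A + Q)⁻¹) := by
    refine (continuousAt_matrix_inv (A + Q) ?_).tendsto.comp hMQ'
    rw [Ring.inverse_eq_inv']
    exact continuousAt_inv₀ hdet
  rw [pseudoinverse_eq_inv_add_sub hQ hQQ hAQ hQA hA]
  refine (hinv.sub_const Q).congr' ?_
  filter_upwards [hunit] with x hx
  exact (pseudoinverse_eq_inv_add_sub hQ hQQ (hMQ x) (hQM x) hx).symm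

/-! ### Weighted graph Laplacians -/

section Laplacian

variable {ι : Type*}

/-- The graph whose edges are the pairs of nonzero weight is connected, expressed through
functions: a function that is constant along the edges is constant. -/
def IsConnectedWeight (c : ι → ι → ℝ) : Prop :=
  ∀ x : ι → ℝ, (∀ i j, c i j ≠ 0 → x i = x j) → ∀ i j, x i = x j

theorem IsConnectedWeight.mono {c d : ι → ι → ℝ} (hc : IsConnectedWeight c)
    (hcd : ∀ i j, c i j ≠ 0 → d i j ≠ 0) : IsConnectedWeight d :=
  fun x hx => hc x fun i j hij => hx i j (hcd i j hij)

variable [Fintype ι]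

variable (ι) in
/-- The matrix of the orthogonal projection onto the constant vectors, which form the kernel of
the Laplacian of a connected graph. -/
noncomputable def avgMatrix : Matrix ι ι ℝ := Matrix.of fun _ _ => (Fintype.card ι : ℝ)⁻¹

theorem avgMatrix_isSymm : (avgMatrix ι).IsSymm := rfl

theorem avgMatrix_mul_self : avgMatrix ι * avgMatrix ι = avgMatrix ι := by
  ext k l
  have : Nonempty ι := ⟨k⟩
  simp [avgMatrix, Matrix.mul_apply]

theorem avgMatrix_mulVec_of_sum_eq_zero {x : ι → ℝ} (hx : ∑ i, x i = 0) :
    avgMatrix ι *ᵥ x = 0 := by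
  ext k
  simp [avgMatrix, Matrix.mulVec, dotProduct, ← Finset.mul_sum, hx]

theorem dotProduct_avgMatrix_mulVec (x : ι → ℝ) :
    x ⬝ᵥ avgMatrix ι *ᵥ x = (Fintype.card ι : ℝ)⁻¹ * (∑ i, x i) ^ 2 := by
  simp only [avgMatrix, Matrix.mulVec, dotProduct, Matrix.of_apply, ← Finset.mul_sum,
    ← Finset.sum_mul]
  ring

variable [DecidableEq ι]

/-- The Laplacian of the graph on `ι` in which the edge `{i, j}` has weight `c i j = c j i`. -/
def laplacian (c : ι → ι → ℝ) : Matrix ι ι ℝ :=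
  Matrix.diagonal (fun i => ∑ j, c i j) - Matrix.of c

theorem laplacian_mulVec (c : ι → ι → ℝ) (x : ι → ℝ) (k : ι) :
    (laplacian c *ᵥ x) k = ∑ j, c k j * (x k - x j) := by
  simp only [laplacian, Matrix.sub_mulVec, Pi.sub_apply, Matrix.mulVec_diagonal, mul_sub,
    Finset.sum_sub_distrib, Finset.sum_mul]
  rfl

theorem laplacian_smul (a : ℝ) (c : ι → ι → ℝ) :
    laplacian (fun i j => a * c i j) = a • laplacian c := by
  ext k l
  simp [laplacian, Matrix.diagonal_apply, ← Finset.mul_sum, mul_sub]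

theorem laplacian_isSymm {c : ι → ι → ℝ} (hc : ∀ i j, c i j = c j i) : (laplacian c).IsSymm :=
  (Matrix.isSymm_diagonal _).sub (Matrix.IsSymm.ext fun i j => hc j i)

theorem tendsto_laplacian {α : Type*} {l : Filter α} {c : α → ι → ι → ℝ} {d : ι → ι → ℝ}
    (h : ∀ i j, Tendsto (fun x => c x i j) l (𝓝 (d i j))) :
    Tendsto (fun x => laplacian (c x)) l (𝓝 (laplacian d)) := by
  have hcont : Continuous (laplacian : (ι → ι → ℝ) → Matrix ι ι ℝ) := by
    unfold laplacian
    refine Continuous.sub (Continuous.matrix_diagonal ?_) continuous_id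
    fun_prop
  exact (hcont.tendsto d).comp (tendsto_pi_nhds.2 fun i => tendsto_pi_nhds.2 (h i))

theorem dotProduct_laplacian_mulVec {c : ι → ι → ℝ} (hc : ∀ i j, c i j = c j i) (x : ι → ℝ) :
    x ⬝ᵥ laplacian c *ᵥ x = (1 / 2) * ∑ i, ∑ j, c i j * (x i - x j) ^ 2 := by
  have hexp : x ⬝ᵥ laplacian c *ᵥ x = ∑ i, ∑ j, c i j * (x i * (x i - x j)) := by
    simp only [dotProduct, laplacian_mulVec, Finset.mul_sum]
    exact Finset.sum_congr rfl fun i _ => Finset.sum_congr rfl fun j _ => by ring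
  have hswap : ∑ i, ∑ j, c i j * (x i * (x i - x j)) = ∑ i, ∑ j, c i j * (x j * (x j - x i)) := by
    rw [Finset.sum_comm]
    exact Finset.sum_congr rfl fun i _ => Finset.sum_congr rfl fun j _ => by rw [hc]
  have hadd : ∑ i, ∑ j, c i j * (x i - x j) ^ 2 =
      ∑ i, ∑ j, c i j * (x i * (x i - x j)) + ∑ i, ∑ j, c i j * (x j * (x j - x i)) := by
    simp only [← Finset.sum_add_distrib]
    exact Finset.sum_congr rfl fun i _ => Finset.sum_congr rfl fun j _ => by ring
  rw [hexp, hadd, ← hswap]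
  ring

theorem laplacian_posSemidef {c : ι → ι → ℝ} (hc : ∀ i j, c i j = c j i) (hc0 : ∀ i j, 0 ≤ c i j) :
    (laplacian c).PosSemidef := by
  refine Matrix.PosSemidef.of_dotProduct_mulVec_nonneg ?_ fun x => ?_
  · simpa [Matrix.IsHermitian] using (laplacian_isSymm hc).eq
  · rw [star_trivial, dotProduct_laplacian_mulVec hc]
    exact mul_nonneg (by norm_num) <| Finset.sum_nonneg fun i _ => Finset.sum_nonneg fun j _ =>
      mul_nonneg (hc0 i j) (sq_nonneg _)

theorem laplacian_mul_avgMatrix (c : ι → ι → ℝ) : laplacian c * avgMatrix ι = 0 := by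
  ext k l
  have := laplacian_mulVec c (fun _ => (Fintype.card ι : ℝ)⁻¹) k
  simpa [Matrix.mul_apply, Matrix.mulVec, dotProduct, avgMatrix] using this

theorem avgMatrix_mul_laplacian {c : ι → ι → ℝ} (hc : ∀ i j, c i j = c j i) :
    avgMatrix ι * laplacian c = 0 := by
  have := congrArg Matrix.transpose (laplacian_mul_avgMatrix c)
  rwa [Matrix.transpose_mul, avgMatrix_isSymm.eq, (laplacian_isSymm hc).eq,
    Matrix.transpose_zero] at this

theorem IsConnectedWeight.eq_zero_of_dotProduct_laplacian_mulVec {c : ι → ι → ℝ}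
    (hconn : IsConnectedWeight c) (hc : ∀ i j, c i j = c j i) (hc0 : ∀ i j, 0 ≤ c i j)
    {x : ι → ℝ} (hx : x ⬝ᵥ laplacian c *ᵥ x = 0) (hsum : ∑ i, x i = 0) : x = 0 := by
  have hnonneg : ∀ i j, 0 ≤ c i j * (x i - x j) ^ 2 :=
    fun i j => mul_nonneg (hc0 i j) (sq_nonneg _)
  have hterm : ∀ i j, c i j * (x i - x j) ^ 2 = 0 := by
    rw [dotProduct_laplacian_mulVec hc, mul_eq_zero_iff_left (by norm_num),
      Fintype.sum_eq_zero_iff_of_nonneg fun i => Finset.sum_nonneg fun j _ => hnonneg i j] at hx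
    exact fun i => congrFun <|
      (Fintype.sum_eq_zero_iff_of_nonneg (hnonneg i)).1 (congrFun hx i)
  have hconst := hconn x fun i j hij => by
    simpa [hij, sub_eq_zero] using hterm i j
  ext i
  have : Nonempty ι := ⟨i⟩
  have hcard : ∑ j, x j = Fintype.card ι * x i := by simp [fun j => hconst j i]
  simpa [hcard] using hsum

theorem IsConnectedWeight.posDef_laplacian_add_avgMatrix {c : ι → ι → ℝ}
    (hconn : IsConnectedWeight c) (hc : ∀ i j, c i j = c j i) (hc0 : ∀ i j, 0 ≤ c i j) :
    (laplacian c + avgMatrix ι).PosDef := by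
  refine Matrix.PosDef.of_dotProduct_mulVec_pos ?_ fun x hx => ?_
  · simpa [Matrix.IsHermitian] using ((laplacian_isSymm hc).add avgMatrix_isSymm).eq
  have : Nonempty ι := (Function.ne_iff.1 hx).nonempty
  have hL := (laplacian_posSemidef hc hc0).dotProduct_mulVec_nonneg x
  have hA : 0 ≤ (Fintype.card ι : ℝ)⁻¹ * (∑ i, x i) ^ 2 := by positivity
  rw [star_trivial] at hL ⊢
  rw [Matrix.add_mulVec, dotProduct_add, dotProduct_avgMatrix_mulVec]
  refine lt_of_le_of_ne (add_nonneg hL hA) fun h0 => hx ?_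
  obtain ⟨hL0, hA0⟩ := (add_eq_zero_iff_of_nonneg hL hA).1 h0.symm
  exact hconn.eq_zero_of_dotProduct_laplacian_mulVec hc hc0 hL0 (by simpa using hA0)

theorem tendsto_pseudoinverse_laplacian {n : ℕ} {α : Type*} {l : Filter α}
    {c : α → Fin n → Fin n → ℝ} {d : Fin n → Fin n → ℝ}
    (h : ∀ i j, Tendsto (fun x => c x i j) l (𝓝 (d i j))) (hc : ∀ x i j, c x i j = c x j i)
    (hd : ∀ i j, d i j = d j i) (hd0 : ∀ i j, 0 ≤ d i j) (hconn : IsConnectedWeight d) :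
    Tendsto (fun x => pseudoinverse (laplacian (c x))) l (𝓝 (pseudoinverse (laplacian d))) :=
  tendsto_pseudoinverse (tendsto_laplacian h) avgMatrix_isSymm avgMatrix_mul_self
    (fun x => laplacian_mul_avgMatrix (c x)) (fun x => avgMatrix_mul_laplacian (hc x))
    (laplacian_mul_avgMatrix d) (avgMatrix_mul_laplacian hd)
    (hconn.posDef_laplacian_add_avgMatrix hd hd0).isUnit

end Laplacian

theorem exists_pos_eventually_le_dotProduct_mulVec {ι : Type*} [Fintype ι] {A : Matrix ι ι ℝ}
    (hA : A.PosDef) :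
    ∃ C > 0, ∀ᶠ M in 𝓝 A, ∀ x : EuclideanSpace ℝ ι, C * ‖x‖ ^ 2 ≤ x.ofLp ⬝ᵥ M *ᵥ x.ofLp := by
  have hcont : Continuous
      fun p : Matrix ι ι ℝ × EuclideanSpace ℝ ι => p.2.ofLp ⬝ᵥ p.1 *ᵥ p.2.ofLp := by
    fun_prop
  have hcompact := isCompact_sphere (0 : EuclideanSpace ℝ ι) 1
  obtain ⟨D, hD, hDA⟩ : ∃ D > 0, ∀ x ∈ Metric.sphere (0 : EuclideanSpace ℝ ι) 1,
      D ≤ x.ofLp ⬝ᵥ A *ᵥ x.ofLp := by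
    refine hcompact.exists_forall_le' (hcont.comp (Continuous.prodMk_right A)).continuousOn
      fun x hx => ?_
    have hx0 : x ≠ 0 := Metric.ne_of_mem_sphere hx one_ne_zero
    simpa using hA.dotProduct_mulVec_pos (x := x.ofLp) (by simpa using hx0)
  have hsphere : ∀ᶠ M in 𝓝 A, ∀ x ∈ Metric.sphere (0 : EuclideanSpace ℝ ι) 1,
      D / 2 < x.ofLp ⬝ᵥ M *ᵥ x.ofLp :=
    hcompact.eventually_forall_of_forall_eventually fun x hx =>
      (hcont.tendsto (A, x)).eventually_const_lt <|
        (half_lt_self hD).trans_le (hDA x hx)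
  refine ⟨D / 2, half_pos hD, ?_⟩
  filter_upwards [hsphere] with M hM x
  rcases eq_or_ne x 0 with rfl | hx
  · simp
  have hnorm := norm_pos_iff.2 hx
  have hunit := hM (‖x‖⁻¹ • x) (by simp [norm_smul, hnorm.ne'])
  rw [WithLp.ofLp_smul, Matrix.mulVec_smul, smul_dotProduct, dotProduct_smul, smul_eq_mul,
    smul_eq_mul, ← mul_assoc, ← sq, inv_pow, ← div_eq_inv_mul, lt_div_iff₀ (by positivity)] at hunit
  exact hunit.le

/-! ### Score and Hessian of the log-likelihood -/

section Score

variable {n : ℕ} (w : Matrix (Fin n) (Fin n) ℕ) (a b : EuclideanSpace ℝ (Fin n)) (i j : Fin n)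

theorem comparisonMatrix_comm : comparisonMatrix w i j = comparisonMatrix w j i := by
  simp only [comparisonMatrix, Matrix.add_apply, Matrix.transpose_apply, add_comm]

variable {w} in
theorem numComparisons_eq_sum (hw : ∀ i, w i i = 0) : numComparisons w = ∑ i, ∑ j, w i j := by
  simp only [numComparisons, comparisonMatrix, Matrix.add_apply, Matrix.transpose_apply]
  rw [Finset.sum_sum_Ioi_add_eq_sum_sum_off_diag (fun i j => w j i)]
  exact Finset.sum_congr rfl fun i _ =>
    Finset.sum_subset (Finset.subset_univ _) fun j _ hj => by
      rw [show j = i by simpa using hj, hw]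

variable {w} in
theorem comparisonMatrix_le_numComparisons (hw : ∀ i, w i i = 0) :
    comparisonMatrix w i j ≤ numComparisons w := by
  rw [numComparisons_eq_sum hw]
  rcases eq_or_ne i j with rfl | hij
  · simp [comparisonMatrix, hw]
  calc comparisonMatrix w i j = w i j + w j i := rfl
    _ ≤ ∑ l, w i l + ∑ l, w j l := add_le_add
        (Finset.single_le_sum (fun _ _ => Nat.zero_le _) (Finset.mem_univ j))
        (Finset.single_le_sum (fun _ _ => Nat.zero_le _) (Finset.mem_univ i))
    _ = ∑ k ∈ {i, j}, ∑ l, w k l := (Finset.sum_pair (f := fun k => ∑ l, w k l) hij).symm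
    _ ≤ ∑ k, ∑ l, w k l := Finset.sum_le_sum_of_subset (Finset.subset_univ _)

theorem sigmoid_sub_swap (s t : ℝ) : Real.sigmoid (t - s) = 1 - Real.sigmoid (s - t) := by
  rw [← Real.sigmoid_neg, neg_sub]

/-- The variance of the outcome of one comparison of `i` with `j`. -/
noncomputable def winVar : ℝ := Real.sigmoid (b i - b j) * Real.sigmoid (b j - b i)

theorem winVar_pos : 0 < winVar b i j := mul_pos (Real.sigmoid_pos _) (Real.sigmoid_pos _)

theorem winVar_comm : winVar b i j = winVar b j i := mul_comm _ _

theorem deriv_sigmoid_sub : deriv Real.sigmoid (b i - b j) = winVar b i j := by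
  rw [Real.deriv_sigmoid, winVar, sigmoid_sub_swap (b i) (b j)]

/-- The score, i.e. the gradient of the log-likelihood: the numbers of wins minus their conditional
expectations given the comparison matrix. -/
noncomputable def score : EuclideanSpace ℝ (Fin n) :=
  WithLp.toLp 2 fun k => ∑ j, ((w k j : ℝ) - comparisonMatrix w k j * Real.sigmoid (b k - b j))

theorem score_apply (k : Fin n) : score w b k =
    ∑ j, ((w k j : ℝ) - comparisonMatrix w k j * Real.sigmoid (b k - b j)) := rfl

theorem sum_sum_mul_sub {ι : Type*} [Fintype ι] (c : ι → ι → ℝ) (x : ι → ℝ) :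
    ∑ i, ∑ j, c i j * (x i - x j) = ∑ i, (∑ j, (c i j - c j i)) * x i := by
  simp only [mul_sub, Finset.sum_sub_distrib, sub_mul, Finset.sum_mul]
  rw [Finset.sum_comm (f := fun i j => c i j * x j)]

theorem inner_score (x : EuclideanSpace ℝ (Fin n)) :
    inner ℝ (score w b) x = ∑ i, ∑ j, (w i j * Real.sigmoid (b j - b i)) * (x i - x j) := by
  rw [sum_sum_mul_sub (fun i j => w i j * Real.sigmoid (b j - b i)) x]
  simp only [PiLp.inner_apply, score_apply, RCLike.inner_apply, conj_trivial, mul_comm (x.ofLp _)]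
  refine Finset.sum_congr rfl fun i _ => ?_
  congr 1
  refine Finset.sum_congr rfl fun j _ => ?_
  rw [sigmoid_sub_swap (b i) (b j)]
  simp only [comparisonMatrix, Matrix.add_apply, Matrix.transpose_apply, Nat.cast_add]
  ring

theorem sum_score : ∑ k, score w b k = 0 := by
  simpa [PiLp.inner_apply] using inner_score w b (WithLp.toLp 2 1)

variable {w} in
theorem norm_score_le (hw : ∀ i, w i i = 0) : ‖score w b‖ ≤ 2 * numComparisons w := by
  rcases (norm_nonneg (score w b)).eq_or_lt' with h0 | h0
  · rw [h0]; positivity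
  refine le_of_mul_le_mul_right ?_ h0
  have hterm : ∀ i j, (w i j * Real.sigmoid (b j - b i)) * (score w b i - score w b j) ≤
      w i j * (2 * ‖score w b‖) := fun i j => by
    have h := abs_sub (score w b i) (score w b j)
    have hi := PiLp.norm_apply_le (score w b) i
    have hj := PiLp.norm_apply_le (score w b) j
    rw [Real.norm_eq_abs] at hi hj
    have hs : Real.sigmoid (b j - b i) * (score w b i - score w b j) ≤ 1 * (2 * ‖score w b‖) :=
      (mul_le_mul_of_nonneg_left ((le_abs_self _).trans (by linarith))
        (Real.sigmoid_nonneg _)).trans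
        (mul_le_mul_of_nonneg_right (Real.sigmoid_le_one _) (by positivity))
    rw [mul_assoc]
    exact mul_le_mul_of_nonneg_left (by linarith) (Nat.cast_nonneg _)
  calc ‖score w b‖ * ‖score w b‖ = inner ℝ (score w b) (score w b) :=
        (real_inner_self_eq_norm_mul_norm _).symm
    _ ≤ ∑ i, ∑ j, (w i j : ℝ) * (2 * ‖score w b‖) := by
        rw [inner_score]
        exact Finset.sum_le_sum fun i _ => Finset.sum_le_sum fun j _ => hterm i j
    _ = 2 * numComparisons w * ‖score w b‖ := by
        simp only [numComparisons_eq_sum hw, Nat.cast_sum, ← Finset.sum_mul]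
        ring

theorem hasDerivAt_log_sigmoid (t : ℝ) :
    HasDerivAt (fun t => Real.log (Real.sigmoid t)) (Real.sigmoid (-t)) t := by
  have h := (Real.hasDerivAt_sigmoid t).log (Real.sigmoid_pos t).ne'
  rwa [mul_div_cancel_left₀ _ (Real.sigmoid_pos t).ne', ← Real.sigmoid_neg] at h

/-- The linear form `x ↦ x i - x j`. -/
noncomputable def contrast : EuclideanSpace ℝ (Fin n) →L[ℝ] ℝ :=
  EuclideanSpace.proj i - EuclideanSpace.proj j

@[simp]
theorem contrast_apply (x : EuclideanSpace ℝ (Fin n)) : contrast i j x = x i - x j := rfl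

theorem hasFDerivAt_pairLogLik :
    HasFDerivAt (pairLogLik i j) (Real.sigmoid (b j - b i) • contrast i j) b := by
  have h := hasDerivAt_log_sigmoid (contrast i j b)
  rw [contrast_apply, neg_sub] at h
  exact HasDerivAt.comp_hasFDerivAt (f := contrast i j) b h (contrast i j).hasFDerivAt

theorem gradient_pairLogLik_apply (k : Fin n) : gradient (pairLogLik i j) b k =
    Real.sigmoid (b j - b i) * contrast i j (EuclideanSpace.single k 1) := by
  have h : inner ℝ (gradient (pairLogLik i j) b) (EuclideanSpace.single k 1) = _ :=
    inner_gradient_left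
  rw [(hasFDerivAt_pairLogLik b i j).fderiv, EuclideanSpace.inner_single_right] at h
  simpa using h

theorem hasFDerivAt_logLik :
    HasFDerivAt (logLik w) (innerSL ℝ (score w b)) b := by
  have h : HasFDerivAt (logLik w) _ b := HasFDerivAt.fun_sum fun i _ =>
    HasFDerivAt.fun_sum fun j _ => (hasFDerivAt_pairLogLik b i j).const_mul _
  refine h.congr_fderiv (ContinuousLinearMap.ext fun x => ?_)
  simp only [innerSL_apply_apply, inner_score, sum_apply, smul_apply, contrast_apply,
    smul_eq_mul, ← mul_assoc]
  exact Finset.sum_congr rfl fun i _ => Finset.sum_erase _ (by simp)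

theorem hasFDerivAt_score_apply (k : Fin n) : HasFDerivAt (fun b => score w b k)
    (-∑ j, ((comparisonMatrix w k j : ℝ) * winVar b k j) • contrast k j) b := by
  have hsigmoid (j : Fin n) : HasFDerivAt (fun b : EuclideanSpace ℝ (Fin n) =>
      Real.sigmoid (b k - b j)) (winVar b k j • contrast k j) b := by
    have h := (Real.hasDerivAt_sigmoid (contrast k j b)).differentiableAt.hasDerivAt
    rw [contrast_apply, deriv_sigmoid_sub] at h
    exact HasDerivAt.comp_hasFDerivAt (f := contrast k j) b h (contrast k j).hasFDerivAt
  simp only [← Finset.sum_neg_distrib, ← smul_smul, score_apply]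
  exact HasFDerivAt.fun_sum fun j _ =>
    ((hsigmoid j).const_mul (comparisonMatrix w k j : ℝ)).const_sub (w k j : ℝ)

theorem hessian_eq :
    hessian w b = -laplacian fun i j => (comparisonMatrix w i j : ℝ) * winVar b i j := by
  have hscore : ∀ l, (fun x => fderiv ℝ (logLik w) x (EuclideanSpace.single l 1)) =
      fun x => score w x l := fun l => funext fun x => by
    rw [(hasFDerivAt_logLik w x).fderiv, innerSL_apply_apply, EuclideanSpace.inner_single_right]
    simp
  rw [← (laplacian_isSymm (c := fun i j => (comparisonMatrix w i j : ℝ) * winVar b i j)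
    fun i j => by rw [comparisonMatrix_comm, winVar_comm]).eq]
  ext k l
  rw [hessian, Matrix.of_apply, hscore, (hasFDerivAt_score_apply w b l).fderiv, Matrix.neg_apply,
    Matrix.transpose_apply, ← Matrix.col_apply (laplacian _), ← Matrix.mulVec_single_one,
    laplacian_mulVec]
  simp [Pi.single_apply]

theorem fisherInfo_eq {P : Matrix (Fin n) (Fin n) ℝ} (hP : ∀ i j, P i j = P j i) :
    fisherInfo P b = laplacian fun i j => P i j * winVar b i j := by
  ext k l
  let e : Fin n → EuclideanSpace ℝ (Fin n) := fun k => EuclideanSpace.single k 1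
  calc fisherInfo P b k l = ∑ i, ∑ j,
        (P i j * winVar b i j * Real.sigmoid (b j - b i) * (e l i - e l j)) * (e k i - e k j) := by
        simp only [fisherInfo, Matrix.of_apply, gradient_pairLogLik_apply, contrast_apply, winVar]
        refine Finset.sum_congr rfl fun i _ => (Finset.sum_erase _ (by simp)).trans ?_
        exact Finset.sum_congr rfl fun j _ => by ring
    _ = ∑ i, (∑ j, P i j * winVar b i j * (e l i - e l j)) * e k i := by
        rw [sum_sum_mul_sub (fun i j => P i j * winVar b i j * Real.sigmoid (b j - b i) *
          (e l i - e l j))]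
        refine Finset.sum_congr rfl fun i _ => congrArg (· * e k i) ?_
        refine Finset.sum_congr rfl fun j _ => ?_
        rw [hP j i, winVar_comm b j i, sigmoid_sub_swap (b i) (b j)]
        ring
    _ = laplacian (fun i j => P i j * winVar b i j) k l := by
        rw [← Matrix.col_apply (laplacian _), ← Matrix.mulVec_single_one, laplacian_mulVec]
        simp [e, Pi.single_apply]

/-- The slope of the sigmoid function between `a i - a j` and `b i - b j`; it takes the place of
`winVar` in finite differences of the score. -/
noncomputable def winSlope : ℝ := dslope Real.sigmoid (a i - a j) (b i - b j)

theorem sigmoid_sub_sigmoid : Real.sigmoid (b i - b j) - Real.sigmoid (a i - a j) =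
    winSlope a b i j * ((b i - a i) - (b j - a j)) := by
  rw [← sub_smul_dslope, smul_eq_mul, winSlope, mul_comm]
  congr 1
  ring

theorem winSlope_pos : 0 < winSlope a b i j := by
  unfold winSlope
  by_cases h : b i - b j = a i - a j
  · rw [h, dslope_same, deriv_sigmoid_sub]
    exact winVar_pos a i j
  · rw [dslope_of_ne _ h]
    exact (Real.sigmoid_strictMono.strictMonoOn Set.univ).slope_pos trivial trivial (Ne.symm h)

theorem winSlope_comm : winSlope a b i j = winSlope a b j i := by
  by_cases h : b i - b j = a i - a j
  · have h' : b j - b i = a j - a i := by linarith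
    rw [winSlope, winSlope, h, h', dslope_same, dslope_same, deriv_sigmoid_sub,
      deriv_sigmoid_sub, winVar_comm]
  · have hij := sigmoid_sub_sigmoid a b i j
    have hji := sigmoid_sub_sigmoid a b j i
    rw [sigmoid_sub_swap (b i), sigmoid_sub_swap (a i)] at hji
    have h0 : (b i - a i) - (b j - a j) ≠ 0 := fun h0 => h (by linarith)
    apply mul_right_cancel₀ h0
    linarith

theorem tendsto_winSlope : Tendsto (fun b => winSlope a b i j) (𝓝 a) (𝓝 (winVar a i j)) := by
  have h : ContinuousAt (dslope Real.sigmoid (a i - a j)) (a i - a j) :=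
    continuousAt_dslope_same.2 (Real.hasDerivAt_sigmoid _).differentiableAt
  rw [ContinuousAt, dslope_same, deriv_sigmoid_sub] at h
  have hc : Continuous fun b : EuclideanSpace ℝ (Fin n) => b i - b j := by fun_prop
  exact h.comp (hc.tendsto a)

theorem continuous_winVar : Continuous fun b : EuclideanSpace ℝ (Fin n) => winVar b i j := by
  unfold winVar
  fun_prop

theorem score_sub_score : (score w b - score w a).ofLp =
    -(laplacian (fun i j => (comparisonMatrix w i j : ℝ) * winSlope a b i j) *ᵥ (b - a).ofLp) := by
  ext k
  simp only [Pi.neg_apply, laplacian_mulVec, score_apply, PiLp.sub_apply, ← Finset.sum_sub_distrib,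
    ← Finset.sum_neg_distrib]
  refine Finset.sum_congr rfl fun j _ => ?_
  linear_combination -(comparisonMatrix w k j : ℝ) * sigmoid_sub_sigmoid a b k j

end Score

/-! ### Existence and uniqueness of the maximum likelihood estimate -/

theorem concaveOn_sum {E ι : Type*} [AddCommGroup E] [Module ℝ E] {s : Set E} {t : Finset ι}
    {f : ι → E → ℝ} (hs : Convex ℝ s) (hf : ∀ i ∈ t, ConcaveOn ℝ s (f i)) :
    ConcaveOn ℝ s fun x => ∑ i ∈ t, f i x := by
  simpa only [Finset.sum_fn] using
    Finset.sum_induction f (ConcaveOn ℝ s) (fun _ _ => ConcaveOn.add) (concaveOn_const 0 hs) hf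

/-- At a maximizer over the intersection of `s` with the closed ball, which exists by compactness,
the derivative is nonpositive in the direction of the centre. -/
theorem exists_norm_sub_lt_isMaxOn_of_apply_sub_neg {E : Type*} [NormedAddCommGroup E]
    [NormedSpace ℝ E] [ProperSpace E] {f : E → ℝ} {f' : E → E →L[ℝ] ℝ} {s : Set E}
    (hs : IsClosed s) (hf : ConcaveOn ℝ s f) (hf' : ∀ x, HasFDerivAt f (f' x) x) {a : E}
    (ha : a ∈ s) {r : ℝ} (hr : 0 < r) (hsphere : ∀ b ∈ s, ‖b - a‖ = r → f' b (b - a) < 0) :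
    ∃ b ∈ s, ‖b - a‖ < r ∧ IsMaxOn f s b := by
  have hcont : Continuous f := continuous_iff_continuousAt.2 fun x => (hf' x).continuousAt
  obtain ⟨b, ⟨hbs, hb⟩, hmax⟩ := ((isCompact_closedBall a r).inter_left hs).exists_isMaxOn
    ⟨a, ha, Metric.mem_closedBall_self hr.le⟩ hcont.continuousOn
  have hbr : ‖b - a‖ ≤ r := mem_closedBall_iff_norm.1 hb
  have hlt : ‖b - a‖ < r := by
    refine hbr.lt_of_ne fun hnorm => (hsphere b hbs hnorm).not_ge ?_
    have hseg : segment ℝ b (b + (a - b)) ⊆ s ∩ Metric.closedBall a r := by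
      rw [add_sub_cancel]
      exact (hf.1.inter (convex_closedBall a r)).segment_subset ⟨hbs, hb⟩
        ⟨ha, Metric.mem_closedBall_self hr.le⟩
    have := hmax.localize.hasFDerivWithinAt_nonpos (hf' b).hasFDerivWithinAt
      (mem_posTangentConeAt_of_segment_subset hseg)
    rwa [← neg_sub b a, map_neg, neg_nonpos] at this
  refine ⟨b, hbs, hlt, IsMaxOn.of_isLocalMaxOn_of_concaveOn hbs ?_ hf⟩
  filter_upwards [self_mem_nhdsWithin, mem_nhdsWithin_of_mem_nhds
    (Metric.isOpen_ball.mem_nhds (mem_ball_iff_norm.2 hlt))] with x hxs hx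
  exact hmax ⟨hxs, Metric.ball_subset_closedBall hx⟩

section MLE

variable {n : ℕ} {w : Matrix (Fin n) (Fin n) ℕ} {a b : EuclideanSpace ℝ (Fin n)}

theorem concaveOn_log_sigmoid : ConcaveOn ℝ Set.univ fun t => Real.log (Real.sigmoid t) := by
  refine Antitone.concaveOn_univ_of_deriv
    (fun t => (hasDerivAt_log_sigmoid t).differentiableAt) fun s t hst => ?_
  rw [(hasDerivAt_log_sigmoid s).deriv, (hasDerivAt_log_sigmoid t).deriv]
  exact Real.sigmoid_monotone (neg_le_neg hst)

theorem concaveOn_logLik (w : Matrix (Fin n) (Fin n) ℕ) : ConcaveOn ℝ Set.univ (logLik w) :=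
  concaveOn_sum convex_univ fun i _ => concaveOn_sum convex_univ fun j _ =>
    (concaveOn_log_sigmoid.comp_linearMap (contrast i j).toLinearMap).smul (Nat.cast_nonneg _)

theorem exists_isSumMLE_of_norm_score_lt (ha : ∑ i, a i = 0) {C r : ℝ} (hr : 0 < r)
    (hC : ∀ b : EuclideanSpace ℝ (Fin n), ∑ i, b i = 0 → ‖b - a‖ = r → C * ‖b - a‖ ^ 2 ≤
      (b - a).ofLp ⬝ᵥ
        laplacian (fun i j => (comparisonMatrix w i j : ℝ) * winSlope a b i j) *ᵥ (b - a).ofLp)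
    (hscore : ‖score w a‖ < C * r) : ∃ b, ‖b - a‖ < r ∧ IsSumMLE w b := by
  let s : Set (EuclideanSpace ℝ (Fin n)) := {b | ∑ i, b i = 0}
  have hs : IsClosed s := isClosed_eq (by fun_prop) continuous_const
  have hconv : Convex ℝ s := fun x hx y hy c d _ _ _ => by
    have hx : ∑ i, x i = 0 := hx
    have hy : ∑ i, y i = 0 := hy
    simp [s, Finset.sum_add_distrib, ← Finset.mul_sum, hx, hy]
  obtain ⟨b, hbs, hbr, hmax⟩ := exists_norm_sub_lt_isMaxOn_of_apply_sub_neg hs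
    ((concaveOn_logLik w).subset (Set.subset_univ s) hconv) (hasFDerivAt_logLik w) ha hr
    fun b hbs hbr => by
      have hdiff : inner ℝ (score w b - score w a) (b - a) ≤ -(C * ‖b - a‖ ^ 2) := by
        rw [EuclideanSpace.inner_eq_star_dotProduct, score_sub_score, star_trivial,
          dotProduct_neg]
        exact neg_le_neg (hC b hbs hbr)
      have hle := real_inner_le_norm (score w a) (b - a)
      rw [inner_sub_left] at hdiff
      rw [hbr] at hdiff hle
      rw [innerSL_apply_apply]
      nlinarith
  exact ⟨b, hbr, hbs, hmax⟩

/-- The score itself is an admissible direction, because its entries sum to zero. -/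
theorem IsSumMLE.score_eq_zero (h : IsSumMLE w b) : score w b = 0 := by
  have hderiv := (hasFDerivAt_logLik w b).hasLineDerivAt (score w b)
  have hmax : IsLocalMax (fun t : ℝ => logLik w (b + t • score w b)) 0 :=
    Eventually.of_forall fun t => by
      simpa using h.2 (b + t • score w b)
        (by simp [Finset.sum_add_distrib, ← Finset.mul_sum, h.1, sum_score])
  simpa using hmax.hasDerivAt_eq_zero hderiv

theorem IsSumMLE.eq_of_isConnectedWeight
    (hconn : IsConnectedWeight fun i j => (comparisonMatrix w i j : ℝ)) (ha : IsSumMLE w a)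
    (hb : IsSumMLE w b) : a = b := by
  have hmean := score_sub_score w a b
  rw [ha.score_eq_zero, hb.score_eq_zero, sub_zero, WithLp.ofLp_zero, eq_comm,
    neg_eq_zero] at hmean
  have hzero := IsConnectedWeight.eq_zero_of_dotProduct_laplacian_mulVec
    (hconn.mono fun i j hij => mul_ne_zero hij (winSlope_pos a b i j).ne')
    (fun i j => by rw [comparisonMatrix_comm, winSlope_comm])
    (fun i j => mul_nonneg (Nat.cast_nonneg _) (winSlope_pos a b i j).le)
    (by rw [hmean, dotProduct_zero]) (by simp [Finset.sum_sub_distrib, ha.1, hb.1])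
  exact (sub_eq_zero.1 ((WithLp.ofLp_eq_zero 2).1 hzero)).symm

theorem logLik_congr (h : ∀ i j, w i j ≠ 0 → a i - a j = b i - b j) : logLik w a = logLik w b := by
  refine Finset.sum_congr rfl fun i _ => Finset.sum_congr rfl fun j _ => ?_
  rcases eq_or_ne (w i j) 0 with hw | hw
  · simp [hw]
  · rw [pairLogLik, pairLogLik, h i j hw]

theorem isConnectedWeight_of_existsUnique_isSumMLE (h : ∃! b, IsSumMLE w b) :
    IsConnectedWeight fun i j => (comparisonMatrix w i j : ℝ) := by
  intro x hx i j
  obtain ⟨b, hb, huniq⟩ := h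
  have hn : (n : ℝ) ≠ 0 := by exact_mod_cast (Fin.pos i).ne'
  set m := (∑ k, x k) / n with hm
  let c : EuclideanSpace ℝ (Fin n) := b + WithLp.toLp 2 fun k => x k - m
  have hc : IsSumMLE w c := by
    refine ⟨?_, fun d hd => (hb.2 d hd).trans_eq (logLik_congr fun k l hkl => ?_)⟩
    · simp [c, Finset.sum_add_distrib, Finset.sum_sub_distrib, hb.1, hm, mul_div_cancel₀ _ hn]
    · have := hx k l (Nat.cast_ne_zero.2 (by simp [comparisonMatrix, hkl]))
      simp [c, this]
  have hmean (k : Fin n) : x k = m := by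
    have := congrArg (fun y : EuclideanSpace ℝ (Fin n) => y k) (huniq c hc)
    simpa [c, sub_eq_zero] using this
  rw [hmean i, hmean j]

end MLE

/-! ### Large-sample behaviour of the maximum likelihood estimate -/

/-- Along the filter `l` the comparisons recorded in `w` have limiting frequencies `p`, for which
the comparison graph is connected. Probability enters only later, through the choice of `l`. -/
structure HasLimitFreq {n : ℕ} {α : Type*} (w : α → Matrix (Fin n) (Fin n) ℕ)
    (p : Fin n → Fin n → ℝ) (l : Filter α) : Prop where
  eventually_pos : ∀ᶠ x in l, 0 < numComparisons (w x)
  tendsto_freq : ∀ i j, Tendsto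
    (fun x => (comparisonMatrix (w x) i j : ℝ) / numComparisons (w x)) l (𝓝 (p i j))
  comm : ∀ i j, p i j = p j i
  nonneg : ∀ i j, 0 ≤ p i j
  connected : IsConnectedWeight p

theorem laplacian_comparisonMatrix_mul {n : ℕ} {w : Matrix (Fin n) (Fin n) ℕ}
    (hw : 0 < numComparisons w) (c : Fin n → Fin n → ℝ) :
    laplacian (fun i j => (comparisonMatrix w i j : ℝ) * c i j) = (numComparisons w : ℝ) •
      laplacian fun i j => (comparisonMatrix w i j : ℝ) / numComparisons w * c i j := by
  have hN : (numComparisons w : ℝ) ≠ 0 := Nat.cast_ne_zero.2 hw.ne'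
  rw [← laplacian_smul]
  congr 1
  ext i j
  field_simp

namespace HasLimitFreq

variable {n : ℕ} {α : Type*} {w : α → Matrix (Fin n) (Fin n) ℕ} {p : Fin n → Fin n → ℝ}
  {l : Filter α} (h : HasLimitFreq w p l) {a : EuclideanSpace ℝ (Fin n)}
include h

theorem eventually_isConnectedWeight :
    ∀ᶠ x in l, IsConnectedWeight fun i j => (comparisonMatrix (w x) i j : ℝ) := by
  have hne : ∀ᶠ x in l, ∀ i j, p i j ≠ 0 → (comparisonMatrix (w x) i j : ℝ) ≠ 0 := by
    refine eventually_all.2 fun i => eventually_all.2 fun j => ?_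
    rw [eventually_imp_distrib_left]
    intro hp
    filter_upwards [(h.tendsto_freq i j).eventually_ne hp] with x hx h0
    simp [h0] at hx
  filter_upwards [hne] with x hx using h.connected.mono hx

theorem exists_pos_eventually_coercive (a : EuclideanSpace ℝ (Fin n)) :
    ∃ C > 0, ∀ᶠ q in l ×ˢ 𝓝 a, ∀ y : EuclideanSpace ℝ (Fin n), ∑ i, y i = 0 →
      C * ‖y‖ ^ 2 ≤ y.ofLp ⬝ᵥ laplacian (fun i j => (comparisonMatrix (w q.1) i j : ℝ) /
        numComparisons (w q.1) * winSlope a q.2 i j) *ᵥ y.ofLp := by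
  obtain ⟨C, hC, hev⟩ := exists_pos_eventually_le_dotProduct_mulVec <|
    IsConnectedWeight.posDef_laplacian_add_avgMatrix
      (h.connected.mono fun i j hij => mul_ne_zero hij (winVar_pos a i j).ne')
      (fun i j => by rw [h.comm, winVar_comm])
      (fun i j => mul_nonneg (h.nonneg i j) (winVar_pos a i j).le)
  have hlim : Tendsto (fun q : α × EuclideanSpace ℝ (Fin n) => laplacian (fun i j =>
      (comparisonMatrix (w q.1) i j : ℝ) / numComparisons (w q.1) * winSlope a q.2 i j) +
        avgMatrix (Fin n)) (l ×ˢ 𝓝 a)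
      (𝓝 (laplacian (fun i j => p i j * winVar a i j) + avgMatrix (Fin n))) :=
    (tendsto_laplacian fun i j => ((h.tendsto_freq i j).comp tendsto_fst).mul
      ((tendsto_winSlope a i j).comp tendsto_snd)).add_const _
  refine ⟨C, hC, (hlim.eventually hev).mono fun q hq y hy => ?_⟩
  simpa [Matrix.add_mulVec, avgMatrix_mulVec_of_sum_eq_zero hy] using hq y

theorem eventually_exists_isSumMLE (ha : ∑ i, a i = 0)
    (hscore : Tendsto (fun x => (numComparisons (w x) : ℝ)⁻¹ • score (w x) a) l (𝓝 0))
    {ε : ℝ} (hε : 0 < ε) : ∀ᶠ x in l, ∃ b, ‖b - a‖ < ε ∧ IsSumMLE (w x) b := by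
  obtain ⟨C, hC, hcoer⟩ := h.exists_pos_eventually_coercive a
  obtain ⟨good, hgood, near, hnear, hcoer⟩ := eventually_prod_iff.1 hcoer
  obtain ⟨δ, hδ, hball⟩ := Metric.eventually_nhds_iff.1 hnear
  obtain ⟨r, hr, hrmin⟩ := exists_between (lt_min hδ hε)
  have hsmall := hscore.norm.eventually_lt_const (u := C * r) (by rw [norm_zero]; positivity)
  filter_upwards [hgood, hsmall, h.eventually_pos] with x hx hsx hpos
  have hN : (0 : ℝ) < numComparisons (w x) := Nat.cast_pos.2 hpos
  obtain ⟨b, hb, hmle⟩ := exists_isSumMLE_of_norm_score_lt (w := w x) ha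
    (C := numComparisons (w x) * C) hr
    (fun b hbsum hbr => by
      have hnearb : near b :=
        hball (by rw [dist_eq_norm, hbr]; exact hrmin.trans_le (min_le_left δ ε))
      have := hcoer hx hnearb (b - a) (by simp [Finset.sum_sub_distrib, ha, hbsum])
      rw [laplacian_comparisonMatrix_mul hpos, Matrix.smul_mulVec, dotProduct_smul, smul_eq_mul,
        mul_assoc]
      exact mul_le_mul_of_nonneg_left this hN.le)
    (by rwa [norm_smul, norm_inv, Real.norm_of_nonneg hN.le, inv_mul_lt_iff₀ hN, ← mul_assoc]
          at hsx)
  exact ⟨b, hb.trans (hrmin.trans_le (min_le_right δ ε)), hmle⟩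

section Estimator

variable {βhat : Matrix (Fin n) (Fin n) ℕ → EuclideanSpace ℝ (Fin n)}

theorem eventually_isSumMLE_and_norm_sub_lt (ha : ∑ i, a i = 0)
    (hscore : Tendsto (fun x => (numComparisons (w x) : ℝ)⁻¹ • score (w x) a) l (𝓝 0))
    (hβhat : ∀ w, (∃! b, IsSumMLE w b) → IsSumMLE w (βhat w)) {ε : ℝ} (hε : 0 < ε) :
    ∀ᶠ x in l, IsSumMLE (w x) (βhat (w x)) ∧ ‖βhat (w x) - a‖ < ε := by
  filter_upwards [h.eventually_isConnectedWeight, h.eventually_exists_isSumMLE ha hscore hε] with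
    x hconn ⟨b, hba, hb⟩
  have hhat := hβhat _ ⟨b, hb, fun c hc => hc.eq_of_isConnectedWeight hconn hb⟩
  exact ⟨hhat, by rwa [hhat.eq_of_isConnectedWeight hconn hb]⟩

theorem eventually_isSumMLE (ha : ∑ i, a i = 0)
    (hscore : Tendsto (fun x => (numComparisons (w x) : ℝ)⁻¹ • score (w x) a) l (𝓝 0))
    (hβhat : ∀ w, (∃! b, IsSumMLE w b) → IsSumMLE w (βhat w)) :
    ∀ᶠ x in l, IsSumMLE (w x) (βhat (w x)) :=
  (h.eventually_isSumMLE_and_norm_sub_lt ha hscore hβhat one_pos).mono fun _ => And.left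

theorem tendsto_estimator (ha : ∑ i, a i = 0)
    (hscore : Tendsto (fun x => (numComparisons (w x) : ℝ)⁻¹ • score (w x) a) l (𝓝 0))
    (hβhat : ∀ w, (∃! b, IsSumMLE w b) → IsSumMLE w (βhat w)) :
    Tendsto (fun x => βhat (w x)) l (𝓝 a) :=
  Metric.tendsto_nhds.2 fun _ hε =>
    (h.eventually_isSumMLE_and_norm_sub_lt ha hscore hβhat hε).mono fun _ hx => by
      simpa only [dist_eq_norm] using hx.2

end Estimator

theorem tendsto_pseudoinverse_laplacian_mul {c : α → Fin n → Fin n → ℝ}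
    (hc : ∀ x i j, c x i j = c x j i)
    (hlim : ∀ i j, Tendsto (fun x => c x i j) l (𝓝 (winVar a i j))) :
    Tendsto (fun x => pseudoinverse (laplacian fun i j =>
        (comparisonMatrix (w x) i j : ℝ) / numComparisons (w x) * c x i j)) l
      (𝓝 (pseudoinverse (laplacian fun i j => p i j * winVar a i j))) :=
  tendsto_pseudoinverse_laplacian (fun i j => (h.tendsto_freq i j).mul (hlim i j))
    (fun x i j => by rw [comparisonMatrix_comm, hc]) (fun i j => by rw [h.comm, winVar_comm])
    (fun i j => mul_nonneg (h.nonneg i j) (winVar_pos a i j).le)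
    (h.connected.mono fun i j hij => mul_ne_zero hij (winVar_pos a i j).ne')

theorem tendsto_neg_pseudoinverse_hessian {b : α → EuclideanSpace ℝ (Fin n)}
    (hb : Tendsto b l (𝓝 a)) :
    Tendsto (fun x => (numComparisons (w x) : ℝ) • -pseudoinverse (hessian (w x) (b x))) l
      (𝓝 (pseudoinverse (laplacian fun i j => p i j * winVar a i j))) := by
  refine (h.tendsto_pseudoinverse_laplacian_mul (fun x i j => winVar_comm (b x) i j)
    fun i j => ((continuous_winVar i j).tendsto a).comp hb).congr' ?_
  filter_upwards [h.eventually_pos] with x hx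
  have hN : (numComparisons (w x) : ℝ) ≠ 0 := Nat.cast_ne_zero.2 hx.ne'
  rw [hessian_eq, laplacian_comparisonMatrix_mul hx, ← neg_smul, pseudoinverse_smul, inv_neg,
    neg_smul, neg_neg, smul_inv_smul₀ hN]

end HasLimitFreq

theorem pseudoinverse_laplacian_mulVec {n : ℕ} {c : Fin n → Fin n → ℝ}
    (hc : ∀ i j, c i j = c j i) (hc0 : ∀ i j, 0 ≤ c i j) (hconn : IsConnectedWeight c)
    {x : Fin n → ℝ} (hx : ∑ i, x i = 0) :
    pseudoinverse (laplacian c) *ᵥ (laplacian c *ᵥ x) = x := by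
  have hunit := (hconn.posDef_laplacian_add_avgMatrix hc hc0).isUnit
  have hdet := (Matrix.isUnit_iff_isUnit_det _).1 hunit
  have hLx : laplacian c *ᵥ x = (laplacian c + avgMatrix (Fin n)) *ᵥ x := by
    rw [Matrix.add_mulVec, avgMatrix_mulVec_of_sum_eq_zero hx, add_zero]
  rw [pseudoinverse_eq_inv_add_sub avgMatrix_isSymm avgMatrix_mul_self (laplacian_mul_avgMatrix c)
    (avgMatrix_mul_laplacian hc) hunit, Matrix.sub_mulVec, Matrix.mulVec_mulVec _ (avgMatrix _),
    avgMatrix_mul_laplacian hc, Matrix.zero_mulVec, sub_zero, hLx, Matrix.mulVec_mulVec,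
    Matrix.nonsing_inv_mul _ hdet, Matrix.one_mulVec]

/-- The matrix that takes the score at `a`, divided by the number of comparisons, to the error
`b - a` of the estimate `b`. -/
noncomputable def errorMatrix {n : ℕ} (w : Matrix (Fin n) (Fin n) ℕ)
    (a b : EuclideanSpace ℝ (Fin n)) : Matrix (Fin n) (Fin n) ℝ :=
  pseudoinverse (laplacian fun i j =>
    (comparisonMatrix w i j : ℝ) / numComparisons w * winSlope a b i j)

theorem IsSumMLE.numComparisons_smul_sub {n : ℕ} {w : Matrix (Fin n) (Fin n) ℕ}
    {a b : EuclideanSpace ℝ (Fin n)} (hb : IsSumMLE w b) (ha : ∑ i, a i = 0)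
    (hw : 0 < numComparisons w)
    (hconn : IsConnectedWeight fun i j => (comparisonMatrix w i j : ℝ)) :
    (numComparisons w : ℝ) • (b - a) =
      Matrix.toEuclideanCLM (𝕜 := ℝ) (errorMatrix w a b) (score w a) := by
  have hN : (0 : ℝ) < numComparisons w := Nat.cast_pos.2 hw
  have hmean := score_sub_score w a b
  rw [hb.score_eq_zero, zero_sub, WithLp.ofLp_neg, neg_inj,
    laplacian_comparisonMatrix_mul hw, Matrix.smul_mulVec, ← Matrix.mulVec_smul] at hmean
  ext1
  rw [Matrix.ofLp_toEuclideanCLM, errorMatrix, hmean, pseudoinverse_laplacian_mulVec]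
  · rfl
  · exact fun i j => by rw [comparisonMatrix_comm, winSlope_comm]
  · exact fun i j => mul_nonneg (by positivity) (winSlope_pos a b i j).le
  · exact hconn.mono fun i j hij =>
      mul_ne_zero (div_ne_zero hij hN.ne') (winSlope_pos a b i j).ne'
  · simp [← Finset.mul_sum, Finset.sum_sub_distrib, hb.1, ha]

theorem HasLimitFreq.tendsto_errorMatrix {n : ℕ} {α : Type*}
    {w : α → Matrix (Fin n) (Fin n) ℕ} {p : Fin n → Fin n → ℝ} {l : Filter α}
    (h : HasLimitFreq w p l) {a : EuclideanSpace ℝ (Fin n)} {b : α → EuclideanSpace ℝ (Fin n)}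
    (hb : Tendsto b l (𝓝 a)) : Tendsto (fun x => errorMatrix (w x) a (b x)) l
      (𝓝 (pseudoinverse (laplacian fun i j => p i j * winVar a i j))) :=
  h.tendsto_pseudoinverse_laplacian_mul (fun x i j => winSlope_comm a (b x) i j)
    fun i j => (tendsto_winSlope a i j).comp hb

/-! ### Limit theorems for dominated independent sequences -/

/-- The filter of those sets of pairs `(i, ω)` whose `i`-sections have probability tending to one
along `l`. Convergence along it to a constant is convergence in probability
(`tendstoInMeasure_const_iff`), so that limit arguments made for arbitrary filters apply. -/
def probFilter {ι Ω : Type*} [MeasurableSpace Ω] (μ : Measure Ω) (l : Filter ι) :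
    Filter (ι × Ω) :=
  Filter.comk (fun A => Tendsto (fun i => μ (Prod.mk i ⁻¹' A)) l (𝓝 0))
    (by simpa only [Set.preimage_empty, measure_empty] using tendsto_const_nhds)
    (fun _ hA _ hBA => tendsto_of_tendsto_of_tendsto_of_le_of_le tendsto_const_nhds hA
      (fun _ => zero_le) fun _ => measure_mono (Set.preimage_mono hBA))
    (fun _ hA _ hB => tendsto_of_tendsto_of_tendsto_of_le_of_le tendsto_const_nhds
      (by rw [← add_zero (0 : ENNReal)]; exact hA.add hB) (fun _ => zero_le)
      fun _ => measure_union_le _ _)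

section ProbFilter

variable {ι Ω : Type*} [MeasurableSpace Ω] {μ : Measure Ω} {l : Filter ι}

theorem eventually_probFilter {p : ι × Ω → Prop} :
    (∀ᶠ x in probFilter μ l, p x) ↔ Tendsto (fun i => μ {ω | ¬ p (i, ω)}) l (𝓝 0) :=
  Iff.rfl

theorem tendsto_fst_probFilter : Tendsto Prod.fst (probFilter μ l) l := fun A hA =>
  eventually_probFilter.2 <| tendsto_const_nhds.congr' <| by
    filter_upwards [hA] with i hi
    simp [hi]

theorem tendstoInMeasure_const_iff {E : Type*} [PseudoMetricSpace E] {f : ι → Ω → E} {c : E} :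
    TendstoInMeasure μ f l (fun _ => c) ↔
      Tendsto (fun x : ι × Ω => f x.1 x.2) (probFilter μ l) (𝓝 c) := by
  simp only [tendstoInMeasure_iff_dist, Metric.tendsto_nhds, eventually_probFilter, not_lt]

end ProbFilter

section Dominated

variable {Ω : Type*} [MeasurableSpace Ω] {μ : Measure Ω} [IsProbabilityMeasure μ]
  {X Y : ℕ → Ω → ℝ}

theorem variance_sum_div_le (hX : Pairwise fun s t => IndepFun (X s) (X t) μ)
    (hXm : ∀ s, Measurable (X s)) (hY : MemLp (Y 0) 2 μ)
    (hYid : ∀ s, IdentDistrib (Y s) (Y 0) μ μ) (hXY : ∀ s ω, |X s ω| ≤ Y s ω) (S : ℕ) :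
    variance (fun ω => (∑ s ∈ Finset.range S, X s ω) / S) μ ≤ (∫ ω, Y 0 ω ^ 2 ∂μ) / S := by
  have hYL : ∀ s, MemLp (Y s) 2 μ := fun s => (hYid s).symm.memLp_snd hY
  have hXL : ∀ s, MemLp (X s) 2 μ := fun s =>
    (hYL s).mono' (hXm s).aestronglyMeasurable (Eventually.of_forall (hXY s))
  have hvar : ∀ s, variance (X s) μ ≤ ∫ ω, Y 0 ω ^ 2 ∂μ := fun s =>
    calc variance (X s) μ ≤ ∫ ω, X s ω ^ 2 ∂μ :=
          variance_le_expectation_sq (hXm s).aestronglyMeasurable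
      _ ≤ ∫ ω, Y s ω ^ 2 ∂μ := integral_mono (hXL s).integrable_sq (hYL s).integrable_sq
          fun ω => sq_le_sq' (abs_le.1 (hXY s ω)).1 (abs_le.1 (hXY s ω)).2
      _ = ∫ ω, Y 0 ω ^ 2 ∂μ := ((hYid s).comp (u := (· ^ 2)) (by fun_prop)).integral_eq
  have hsum : variance (fun ω => ∑ s ∈ Finset.range S, X s ω) μ ≤ S * ∫ ω, Y 0 ω ^ 2 ∂μ := by
    simp only [← Finset.sum_apply]
    rw [IndepFun.variance_sum (fun s _ => hXL s) (fun s _ t _ hst => hX hst)]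
    exact (Finset.sum_le_card_nsmul _ _ _ fun s _ => hvar s).trans_eq (by simp)
  rw [funext fun ω => div_eq_inv_mul (∑ s ∈ Finset.range S, X s ω) (S : ℝ), variance_const_mul]
  rcases S.eq_zero_or_pos with rfl | hS
  · simp
  · calc (S : ℝ)⁻¹ ^ 2 * variance (fun ω => ∑ s ∈ Finset.range S, X s ω) μ
        ≤ (S : ℝ)⁻¹ ^ 2 * (S * ∫ ω, Y 0 ω ^ 2 ∂μ) := by gcongr
      _ = (∫ ω, Y 0 ω ^ 2 ∂μ) / S := by field_simp

theorem tendstoInMeasure_sum_div (hX : Pairwise fun s t => IndepFun (X s) (X t) μ)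
    (hXm : ∀ s, Measurable (X s)) (hY : MemLp (Y 0) 2 μ)
    (hYid : ∀ s, IdentDistrib (Y s) (Y 0) μ μ) (hXY : ∀ s ω, |X s ω| ≤ Y s ω) {m : ℝ}
    (hm : ∀ s, ∫ ω, X s ω ∂μ = m) :
    TendstoInMeasure μ (fun (S : ℕ) ω => (∑ s ∈ Finset.range S, X s ω) / S) atTop
      fun _ => m := by
  have hXL : ∀ s, MemLp (X s) 2 μ := fun s => ((hYid s).symm.memLp_snd hY).mono'
    (hXm s).aestronglyMeasurable (Eventually.of_forall (hXY s))
  rw [tendstoInMeasure_iff_norm]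
  intro ε hε
  have hbound : Tendsto (fun S : ℕ => ENNReal.ofReal ((∫ ω, Y 0 ω ^ 2 ∂μ) / S / ε ^ 2)) atTop
      (𝓝 0) := by
    simpa using ENNReal.tendsto_ofReal
      ((tendsto_const_div_atTop_nhds_zero_nat (∫ ω, Y 0 ω ^ 2 ∂μ)).div_const (ε ^ 2))
  refine tendsto_of_tendsto_of_tendsto_of_le_of_le' tendsto_const_nhds hbound
    (Eventually.of_forall fun _ => zero_le) ?_
  filter_upwards [eventually_gt_atTop 0] with S hS
  have hmean : ∫ ω, (∑ s ∈ Finset.range S, X s ω) / S ∂μ = m := by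
    rw [integral_div, integral_finsetSum _ fun s _ => (hXL s).integrable one_le_two]
    simp [hm, hS.ne']
  have hL : MemLp (fun ω => (∑ s ∈ Finset.range S, X s ω) / S) 2 μ := by
    simpa only [div_eq_mul_inv] using (memLp_finsetSum _ fun s _ => hXL s).mul_const (S : ℝ)⁻¹
  have hcheb := meas_ge_le_variance_div_sq hL hε
  rw [hmean] at hcheb
  exact hcheb.trans <| ENNReal.ofReal_le_ofReal <|
    div_le_div_of_nonneg_right (variance_sum_div_le hX hXm hY hYid hXY S) (sq_nonneg ε)

end Dominated

theorem norm_exp_mul_I_sub_le (x : ℝ) :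
    ‖Complex.exp (x * Complex.I) - (1 + x * Complex.I - (x : ℂ) ^ 2 / 2)‖ ≤
      4 * (x ^ 2 * min |x| 1) := by
  rcases le_total |x| 1 with h | h
  · have hn : ‖(x : ℂ) * Complex.I‖ = |x| := by simp
    have hb := Complex.exp_bound (x := x * Complex.I) (by rwa [hn]) (n := 3) (by norm_num)
    have hsum : ∑ m ∈ Finset.range 3, ((x : ℂ) * Complex.I) ^ m / (m.factorial : ℂ) =
        1 + x * Complex.I - (x : ℂ) ^ 2 / 2 := by
      simp [Finset.sum_range_succ, mul_pow, Nat.factorial]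
      ring
    rw [hn, hsum] at hb
    calc ‖Complex.exp (x * Complex.I) - (1 + x * Complex.I - (x : ℂ) ^ 2 / 2)‖
        ≤ |x| ^ 3 * 4 := hb.trans (by gcongr; norm_num [Nat.factorial])
      _ = 4 * (x ^ 2 * min |x| 1) := by rw [min_eq_left h, ← sq_abs x]; ring
  · have hexp : ‖Complex.exp (x * Complex.I)‖ = 1 := Complex.norm_exp_ofReal_mul_I x
    have hpoly : ‖(1 : ℂ) + x * Complex.I - (x : ℂ) ^ 2 / 2‖ ≤ 1 + |x| + x ^ 2 / 2 := by
      refine (norm_sub_le _ _).trans (add_le_add ((norm_add_le _ _).trans ?_) ?_) <;> simp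
    have hsub := norm_sub_le (Complex.exp (x * Complex.I)) (1 + x * Complex.I - (x : ℂ) ^ 2 / 2)
    rw [min_eq_right h]
    nlinarith [sq_abs x]

theorem norm_prod_sub_prod_le {ι : Type*} (s : Finset ι) (a b : ι → ℂ)
    (ha : ∀ i ∈ s, ‖a i‖ ≤ 1) (hb : ∀ i ∈ s, ‖b i‖ ≤ 1) :
    ‖∏ i ∈ s, a i - ∏ i ∈ s, b i‖ ≤ ∑ i ∈ s, ‖a i - b i‖ := by
  induction s using Finset.cons_induction with
  | empty => simp
  | cons i s hi ih =>
    rw [Finset.forall_mem_cons] at ha hb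
    have hprod : ‖∏ j ∈ s, a j‖ ≤ 1 := by
      rw [norm_prod]
      exact Finset.prod_le_one (fun _ _ => norm_nonneg _) ha.2
    rw [Finset.prod_cons, Finset.prod_cons, Finset.sum_cons]
    calc ‖a i * ∏ j ∈ s, a j - b i * ∏ j ∈ s, b j‖
        = ‖(a i - b i) * ∏ j ∈ s, a j + b i * (∏ j ∈ s, a j - ∏ j ∈ s, b j)‖ := by ring_nf
      _ ≤ ‖a i - b i‖ * ‖∏ j ∈ s, a j‖ + ‖b i‖ * ‖∏ j ∈ s, a j - ∏ j ∈ s, b j‖ := by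
          simpa only [norm_mul] using norm_add_le ((a i - b i) * ∏ j ∈ s, a j)
            (b i * (∏ j ∈ s, a j - ∏ j ∈ s, b j))
      _ ≤ ‖a i - b i‖ * 1 + 1 * ∑ j ∈ s, ‖a j - b j‖ := by
          gcongr
          exacts [hb.1, ih ha.2 hb.2]
      _ = ‖a i - b i‖ + ∑ j ∈ s, ‖a j - b j‖ := by ring

section CentralLimit

variable {Ω : Type*} [MeasurableSpace Ω] {μ : Measure Ω}

theorem integrable_sq_mul_min {Y : Ω → ℝ} (hY : MemLp Y 2 μ) (hY0 : ∀ ω, 0 ≤ Y ω) :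
    Integrable (fun ω => Y ω ^ 2 * min (Y ω) 1) μ := by
  refine hY.integrable_sq.mono' ((hY.aestronglyMeasurable.pow 2).mul
    (hY.aestronglyMeasurable.inf aestronglyMeasurable_const)) (Eventually.of_forall fun ω => ?_)
  rw [Real.norm_of_nonneg (mul_nonneg (sq_nonneg _) (le_min (hY0 ω) zero_le_one))]
  exact mul_le_of_le_one_right (sq_nonneg _) (min_le_right _ _)

theorem tendsto_integral_sq_mul_min {Y : Ω → ℝ} (hY : MemLp Y 2 μ) (hY0 : ∀ ω, 0 ≤ Y ω) :
    Tendsto (fun S : ℕ => ∫ ω, Y ω ^ 2 * min ((√S)⁻¹ * Y ω) 1 ∂μ) atTop (𝓝 0) := by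
  have hinv : Tendsto (fun S : ℕ => (√(S : ℝ))⁻¹) atTop (𝓝 0) :=
    tendsto_inv_atTop_zero.comp (Real.tendsto_sqrt_atTop.comp tendsto_natCast_atTop_atTop)
  rw [← integral_zero Ω ℝ (μ := μ)]
  refine tendsto_integral_of_dominated_convergence (fun ω => Y ω ^ 2)
    (fun S => (hY.aestronglyMeasurable.pow 2).mul
      ((hY.aestronglyMeasurable.const_mul _).inf aestronglyMeasurable_const)) hY.integrable_sq
    (fun S => Eventually.of_forall fun ω => ?_) (Eventually.of_forall fun ω => ?_)
  · have hmin : 0 ≤ min ((√(S : ℝ))⁻¹ * Y ω) 1 :=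
      le_min (mul_nonneg (by positivity) (hY0 ω)) zero_le_one
    rw [Real.norm_of_nonneg (mul_nonneg (sq_nonneg _) hmin)]
    exact mul_le_of_le_one_right (sq_nonneg _) (min_le_right _ _)
  · simpa using ((hinv.mul_const (Y ω)).min (tendsto_const_nhds (x := (1 : ℝ)))).const_mul
      (Y ω ^ 2)

variable [IsProbabilityMeasure μ]

theorem integral_one_add_mul_I_sub_sq_div_two {X : Ω → ℝ} (hX : MemLp X 2 μ)
    (h0 : ∫ ω, X ω ∂μ = 0) :
    Integrable (fun ω => 1 + (X ω : ℂ) * Complex.I - (X ω : ℂ) ^ 2 / 2) μ ∧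
      ∫ ω, (1 + (X ω : ℂ) * Complex.I - (X ω : ℂ) ^ 2 / 2) ∂μ =
        1 - ((∫ ω, X ω ^ 2 ∂μ : ℝ) : ℂ) / 2 := by
  have hlin : Integrable (fun ω => 1 + (X ω : ℂ) * Complex.I) μ :=
    (integrable_const 1).add ((hX.integrable one_le_two).ofReal.mul_const _)
  have hsq : Integrable (fun ω => (X ω : ℂ) ^ 2 / 2) μ := by
    simpa using (hX.integrable_sq.ofReal (𝕜 := ℂ)).div_const 2
  refine ⟨hlin.sub hsq, ?_⟩
  rw [integral_sub hlin hsq, integral_add (integrable_const 1)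
    ((hX.integrable one_le_two).ofReal.mul_const _), integral_mul_const, integral_div,
    integral_complex_ofReal, h0]
  simp [← integral_complex_ofReal]

theorem norm_integral_exp_mul_I_sub_le {X Y : Ω → ℝ} (hXm : Measurable X) (hY : MemLp Y 2 μ)
    (hXY : ∀ ω, |X ω| ≤ Y ω) (h0 : ∫ ω, X ω ∂μ = 0) :
    ‖∫ ω, Complex.exp (X ω * Complex.I) ∂μ - (1 - ((∫ ω, X ω ^ 2 ∂μ : ℝ) : ℂ) / 2)‖ ≤
      4 * ∫ ω, Y ω ^ 2 * min (Y ω) 1 ∂μ := by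
  have hXL : MemLp X 2 μ := hY.mono' hXm.aestronglyMeasurable (Eventually.of_forall hXY)
  have hexp : Integrable (fun ω => Complex.exp (X ω * Complex.I)) μ :=
    Integrable.of_bound (C := 1)
      (by fun_prop : Measurable fun ω => Complex.exp (X ω * Complex.I)).aestronglyMeasurable
      (Eventually.of_forall fun ω => (Complex.norm_exp_ofReal_mul_I _).le)
  obtain ⟨hint, hval⟩ := integral_one_add_mul_I_sub_sq_div_two hXL h0
  rw [← hval, ← integral_sub hexp hint, ← integral_const_mul]
  refine norm_integral_le_of_norm_le
    ((integrable_sq_mul_min hY fun ω => (abs_nonneg _).trans (hXY ω)).const_mul 4)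
    (Eventually.of_forall fun ω => (norm_exp_mul_I_sub_le (X ω)).trans ?_)
  rw [← sq_abs (X ω)]
  gcongr <;> exact hXY ω

theorem norm_charFun_map_sub_le {X Y : Ω → ℝ} (hXm : Measurable X) (hY : MemLp Y 2 μ)
    (hXY : ∀ ω, |X ω| ≤ Y ω) (h0 : ∫ ω, X ω ∂μ = 0) {t : ℝ} (ht : 0 ≤ t) :
    ‖charFun (μ.map X) t - (1 - ((t ^ 2 * ∫ ω, X ω ^ 2 ∂μ : ℝ) : ℂ) / 2)‖ ≤
      4 * (t ^ 2 * ∫ ω, Y ω ^ 2 * min (t * Y ω) 1 ∂μ) := by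
  have h := norm_integral_exp_mul_I_sub_le (X := fun ω => t * X ω) (Y := fun ω => t * Y ω)
    (hXm.const_mul t) (hY.const_mul t)
    (fun ω => by rw [abs_mul, abs_of_nonneg ht]; exact mul_le_mul_of_nonneg_left (hXY ω) ht)
    (by rw [integral_const_mul, h0, mul_zero])
  rw [charFun_apply_real, integral_map hXm.aemeasurable (by fun_prop)]
  simpa only [mul_pow, mul_assoc, integral_const_mul, Complex.ofReal_mul] using h

variable {X Y : ℕ → Ω → ℝ} {τ : ℝ}

theorem norm_charFun_map_sum_sub_le (hX : iIndepFun X μ) (hXm : ∀ s, Measurable (X s))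
    (hY : MemLp (Y 0) 2 μ) (hYid : ∀ s, IdentDistrib (Y s) (Y 0) μ μ)
    (hXY : ∀ s ω, |X s ω| ≤ Y s ω) (h0 : ∀ s, ∫ ω, X s ω ∂μ = 0)
    (hτ : ∀ s, ∫ ω, X s ω ^ 2 ∂μ = τ) {S : ℕ} (hS : 0 < S) (hSτ : τ ≤ S) :
    ‖charFun (μ.map fun ω => ∑ s ∈ Finset.range S, X s ω) (√S)⁻¹ - (1 + (-(τ : ℂ) / 2) / S) ^ S‖
      ≤ 4 * ∫ ω, Y 0 ω ^ 2 * min ((√S)⁻¹ * Y 0 ω) 1 ∂μ := by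
  have hS' : (0 : ℝ) < S := Nat.cast_pos.2 hS
  have hτ0 : 0 ≤ τ := hτ 0 ▸ integral_nonneg fun ω => sq_nonneg (X 0 ω)
  have hsq : (√(S : ℝ))⁻¹ ^ 2 = (S : ℝ)⁻¹ := by rw [inv_pow, Real.sq_sqrt hS'.le]
  have hbase : (1 : ℂ) + (-(τ : ℂ) / 2) / S = 1 - (((S : ℝ)⁻¹ * τ : ℝ) : ℂ) / 2 := by
    push_cast
    ring
  have hbase_le : ‖(1 : ℂ) + (-(τ : ℂ) / 2) / S‖ ≤ 1 := by
    have hle : (S : ℝ)⁻¹ * τ ≤ 1 := by rwa [inv_mul_le_iff₀ hS', mul_one]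
    have hnn : 0 ≤ (S : ℝ)⁻¹ * τ := by positivity
    rw [hbase, show (1 : ℂ) - (((S : ℝ)⁻¹ * τ : ℝ) : ℂ) / 2 = ((1 - (S : ℝ)⁻¹ * τ / 2 : ℝ) : ℂ) by
      push_cast; rfl, Complex.norm_real, Real.norm_eq_abs, abs_le]
    constructor <;> linarith
  have hterm : ∀ s, ‖charFun (μ.map (X s)) (√S)⁻¹ - (1 + (-(τ : ℂ) / 2) / S)‖ ≤
      4 * ((S : ℝ)⁻¹ * ∫ ω, Y 0 ω ^ 2 * min ((√S)⁻¹ * Y 0 ω) 1 ∂μ) := fun s => by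
    have h := norm_charFun_map_sub_le (hXm s) ((hYid s).symm.memLp_snd hY) (hXY s) (h0 s)
      (t := (√S)⁻¹) (by positivity)
    have hid : ∫ ω, Y s ω ^ 2 * min ((√S)⁻¹ * Y s ω) 1 ∂μ =
        ∫ ω, Y 0 ω ^ 2 * min ((√S)⁻¹ * Y 0 ω) 1 ∂μ :=
      ((hYid s).comp (u := fun y => y ^ 2 * min ((√S)⁻¹ * y) 1) (by fun_prop)).integral_eq
    rwa [hτ s, hsq, ← hbase, hid] at h
  have hprob : ∀ s, IsProbabilityMeasure (μ.map (X s)) := fun s =>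
    Measure.isProbabilityMeasure_map (hXm s).aemeasurable
  have hprod := norm_prod_sub_prod_le (Finset.range S) (fun s => charFun (μ.map (X s)) (√S)⁻¹)
    (fun _ => 1 + (-(τ : ℂ) / 2) / S) (fun s _ => norm_charFun_le_one _) fun _ _ => hbase_le
  rw [(hX.restrict _).charFun_map_fun_finsetSum_eq_prod fun s _ => (hXm s).aemeasurable]
  simp only [Finset.prod_apply, Finset.prod_const, Finset.card_range] at hprod ⊢
  refine hprod.trans ((Finset.sum_le_card_nsmul _ _ _ fun s _ => hterm s).trans_eq ?_)
  rw [Finset.card_range, nsmul_eq_mul]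
  field_simp

theorem tendsto_charFun_map_sum (hX : iIndepFun X μ) (hXm : ∀ s, Measurable (X s))
    (hY : MemLp (Y 0) 2 μ) (hYid : ∀ s, IdentDistrib (Y s) (Y 0) μ μ)
    (hXY : ∀ s ω, |X s ω| ≤ Y s ω) (h0 : ∀ s, ∫ ω, X s ω ∂μ = 0)
    (hτ : ∀ s, ∫ ω, X s ω ^ 2 ∂μ = τ) :
    Tendsto (fun S : ℕ => charFun (μ.map fun ω => ∑ s ∈ Finset.range S, X s ω) (√S)⁻¹) atTop
      (𝓝 (Complex.exp (-(τ : ℂ) / 2))) := by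
  refine (Complex.tendsto_one_add_div_pow_exp (-(τ : ℂ) / 2)).congr_dist ?_
  have hlim := (tendsto_integral_sq_mul_min hY fun ω =>
    (abs_nonneg _).trans (hXY 0 ω)).const_mul 4
  rw [mul_zero] at hlim
  refine squeeze_zero' (Eventually.of_forall fun _ => dist_nonneg) ?_ hlim
  filter_upwards [eventually_gt_atTop 0, eventually_ge_atTop ⌈τ⌉₊] with S hS hSτ
  rw [dist_comm, dist_eq_norm]
  exact norm_charFun_map_sum_sub_le hX hXm hY hYid hXY h0 hτ hS (Nat.ceil_le.1 hSτ)

theorem tendstoInDistribution_inv_sqrt_smul_sum {ι : Type*} [Fintype ι] [DecidableEq ι]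
    {X : ℕ → Ω → EuclideanSpace ℝ ι} {A : Matrix ι ι ℝ} (hX : iIndepFun X μ)
    (hXm : ∀ s, Measurable (X s)) (hY : MemLp (Y 0) 2 μ)
    (hYid : ∀ s, IdentDistrib (Y s) (Y 0) μ μ) (hXY : ∀ s ω, ‖X s ω‖ ≤ Y s ω)
    (h0 : ∀ s t, ∫ ω, inner ℝ (X s ω) t ∂μ = 0) (hA : A.PosSemidef)
    (hcov : ∀ s t, ∫ ω, inner ℝ (X s ω) t ^ 2 ∂μ = t.ofLp ⬝ᵥ A *ᵥ t.ofLp) :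
    TendstoInDistribution (fun (S : ℕ) ω => (√S)⁻¹ • ∑ s ∈ Finset.range S, X s ω) atTop id
      (fun _ => μ) (multivariateGaussian 0 A) where
  forall_aemeasurable S := by fun_prop
  aemeasurable_limit := aemeasurable_id
  tendsto := by
    refine ProbabilityMeasure.tendsto_iff_tendsto_charFun.2 fun t => ?_
    have hclt := tendsto_charFun_map_sum (X := fun s ω => inner ℝ (X s ω) t)
      (Y := fun s ω => ‖t‖ * Y s ω)
      (hX.comp (fun _ x => inner ℝ x t) fun _ => measurable_id.inner_const)
      (fun s => (hXm s).inner_const) (hY.const_mul _)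
      (fun s => (hYid s).comp (u := (‖t‖ * ·)) (by fun_prop))
      (fun s ω => (abs_real_inner_le_norm (X s ω) t).trans <| (mul_comm _ _).trans_le <|
        mul_le_mul_of_nonneg_left (hXY s ω) (norm_nonneg t))
      (fun s => h0 s t) (fun s => hcov s t)
    have hlimit : charFun ((multivariateGaussian 0 A).map id) t =
        Complex.exp (-((t.ofLp ⬝ᵥ A *ᵥ t.ofLp : ℝ) : ℂ) / 2) := by
      rw [Measure.map_id, charFun_multivariateGaussian hA]
      simp [neg_div]
    simp only [ProbabilityMeasure.coe_mk, hlimit]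
    refine hclt.congr fun S => ?_
    rw [charFun_apply, charFun_apply, integral_map (by fun_prop) (by fun_prop),
      integral_map (by fun_prop) (by fun_prop)]
    simp [inner_smul_left, sum_inner, mul_comm]

end CentralLimit

/-! ### Moments of the score under the Bradley–Terry model -/

section Outcomes

variable {n : ℕ} (v w : Matrix (Fin n) (Fin n) ℕ) (b t : EuclideanSpace ℝ (Fin n))

theorem finite_setOf_comparisonMatrix_eq :
    {w : Matrix (Fin n) (Fin n) ℕ | comparisonMatrix w = v}.Finite :=
  Set.Finite.subset (Set.finite_Iic (α := Fin n → Fin n → ℕ) v) fun w hw i j =>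
    (Nat.le_add_right (w i j) (w j i)).trans_eq (congrFun₂ hw i j)

/-- The contingency matrices with comparison matrix `v`: the possible outcomes of the comparisons
counted by `v`. -/
noncomputable def outcomes : Finset (Matrix (Fin n) (Fin n) ℕ) :=
  (finite_setOf_comparisonMatrix_eq v).toFinset

variable {v w} in
@[simp]
theorem mem_outcomes : w ∈ outcomes v ↔ comparisonMatrix w = v := by
  simp [outcomes]

theorem outcomeProb_eq_prod_sigma : outcomeProb b w =
    ∏ e : (i : Fin n) × Finset.Ioi i, ((comparisonMatrix w e.1 e.2).choose (w e.1 e.2) : ℝ) *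
      (Real.sigmoid (b e.1 - b e.2) ^ w e.1 e.2 * Real.sigmoid (b e.2 - b e.1) ^ w e.2 e.1) := by
  rw [Fintype.prod_sigma]
  refine Finset.prod_congr rfl fun i _ => ?_
  rw [Finset.prod_coe_sort (Finset.Ioi i) fun j => ((comparisonMatrix w i j).choose (w i j) : ℝ) *
    (Real.sigmoid (b i - b j) ^ w i j * Real.sigmoid (b j - b i) ^ w j i)]
  exact Finset.prod_congr rfl fun j _ => mul_assoc _ _ _

/-- The contingency matrix with the diagonal of `w` in which, for `i < j`, object `i` beats object
`j` exactly `(k ⟨i, j⟩).1` times and loses to it `(k ⟨i, j⟩).2` times. -/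
def ofResults (k : ((i : Fin n) × Finset.Ioi i) → ℕ × ℕ) : Matrix (Fin n) (Fin n) ℕ :=
  Matrix.of fun i j => if h : i < j then (k ⟨i, j, Finset.mem_Ioi.2 h⟩).1 else
    if h : j < i then (k ⟨j, i, Finset.mem_Ioi.2 h⟩).2 else w i i

variable {w} in
theorem ofResults_of_comparisonMatrix_eq {w' : Matrix (Fin n) (Fin n) ℕ}
    (h : comparisonMatrix w' = comparisonMatrix w) :
    ofResults w (fun e => (w' e.1 e.2, w' e.2 e.1)) = w' := by
  ext i j
  rcases lt_trichotomy i j with hij | rfl | hij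
  · simp [ofResults, hij]
  · have := congrFun₂ h i i
    simp only [comparisonMatrix, Matrix.add_apply, Matrix.transpose_apply] at this
    simp only [ofResults, Matrix.of_apply, lt_irrefl, dite_false]
    omega
  · simp [ofResults, hij, hij.not_gt]

variable {w} in
theorem comparisonMatrix_ofResults {k : ((i : Fin n) × Finset.Ioi i) → ℕ × ℕ}
    (hk : ∀ e, (k e).1 + (k e).2 = comparisonMatrix w e.1 e.2) :
    comparisonMatrix (ofResults w k) = comparisonMatrix w := by
  have hlt {i j : Fin n} (hij : i < j) :
      comparisonMatrix (ofResults w k) i j = comparisonMatrix w i j := by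
    simpa [comparisonMatrix, ofResults, hij, hij.not_gt] using hk ⟨i, j, Finset.mem_Ioi.2 hij⟩
  ext i j
  rcases lt_trichotomy i j with hij | rfl | hij
  · exact hlt hij
  · simp [comparisonMatrix, ofResults]
  · rw [comparisonMatrix_comm, hlt hij, comparisonMatrix_comm]

theorem sum_outcomeProb : ∑ w' ∈ outcomes (comparisonMatrix w), outcomeProb b w' = 1 := by
  let v (e : (i : Fin n) × Finset.Ioi i) : ℕ := comparisonMatrix w e.1 e.2
  let p (e : (i : Fin n) × Finset.Ioi i) (k : ℕ × ℕ) : ℝ := ((v e).choose k.1 : ℝ) *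
    (Real.sigmoid (b e.1 - b e.2) ^ k.1 * Real.sigmoid (b e.2 - b e.1) ^ k.2)
  have hp (e) : ∑ k ∈ Finset.HasAntidiagonal.antidiagonal (v e), p e k = 1 := by
    have h := (Commute.all (Real.sigmoid (b e.1 - b e.2)) (Real.sigmoid (b e.2 - b e.1))).add_pow'
      (v e)
    rw [sigmoid_sub_swap (b e.1) (b e.2), add_sub_cancel, one_pow,
      ← sigmoid_sub_swap (b e.1) (b e.2)] at h
    simpa only [nsmul_eq_mul] using h.symm
  calc ∑ w' ∈ outcomes (comparisonMatrix w), outcomeProb b w'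
      = ∑ k ∈ Fintype.piFinset fun e => Finset.HasAntidiagonal.antidiagonal (v e),
          ∏ e, p e (k e) := by
        refine Finset.sum_nbij' (fun w' e => (w' e.1 e.2, w' e.2 e.1)) (ofResults w) ?_ ?_ ?_ ?_ ?_
        · intro w' hw'
          simp only [Fintype.mem_piFinset, v, ← mem_outcomes.1 hw']
          exact fun e => Finset.HasAntidiagonal.mem_antidiagonal.2 rfl
        · intro k hk
          exact mem_outcomes.2 (comparisonMatrix_ofResults (by simpa using hk))
        · exact fun w' hw' => ofResults_of_comparisonMatrix_eq (mem_outcomes.1 hw')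
        · intro k _
          ext ⟨i, j, hij⟩ <;>
            simp [ofResults, Finset.mem_Ioi.1 hij, (Finset.mem_Ioi.1 hij).not_gt]
        · intro w' hw'
          simp only [outcomeProb_eq_prod_sigma, p, v, ← mem_outcomes.1 hw']
    _ = ∏ e, ∑ k ∈ Finset.HasAntidiagonal.antidiagonal (v e), p e k :=
        (Finset.prod_univ_sum _ _).symm
    _ = 1 := Finset.prod_eq_one fun e _ => hp e

theorem outcomeProb_eq_mul_exp_logLik : outcomeProb b w =
    (∏ i, ∏ j ∈ Finset.Ioi i, ((comparisonMatrix w i j).choose (w i j) : ℝ)) *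
      Real.exp (logLik w b) := by
  have hexp : Real.exp (logLik w b) =
      ∏ i, ∏ j ∈ {i}ᶜ, Real.sigmoid (b i - b j) ^ w i j := by
    simp only [logLik, pairLogLik, Real.exp_sum, ← Finset.compl_singleton, Real.exp_nat_mul,
      Real.exp_log (Real.sigmoid_pos _)]
  rw [hexp, ← Finset.prod_prod_Ioi_mul_eq_prod_prod_off_diag fun j i =>
    Real.sigmoid (b i - b j) ^ w i j]
  simp only [outcomeProb, Finset.prod_mul_distrib, mul_assoc]

theorem hasDerivAt_outcomeProb (u : ℝ) : HasDerivAt (fun u : ℝ => outcomeProb (b + u • t) w)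
    (outcomeProb (b + u • t) w * inner ℝ (score w (b + u • t)) t) u := by
  have hline : HasDerivAt (fun u : ℝ => b + u • t) t u := by
    simpa using ((hasDerivAt_id u).smul_const t).const_add b
  simp only [outcomeProb_eq_mul_exp_logLik, mul_assoc]
  exact ((hasFDerivAt_logLik w _).comp_hasDerivAt u hline).exp.const_mul _

theorem hasDerivAt_inner_score (u : ℝ) :
    HasDerivAt (fun u : ℝ => inner ℝ (score w (b + u • t)) t)
      (-(t.ofLp ⬝ᵥ (laplacian fun i j => (comparisonMatrix w i j : ℝ) * winVar (b + u • t) i j) *ᵥ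
        t.ofLp)) u := by
  have hline : HasDerivAt (fun u : ℝ => b + u • t) t u := by
    simpa using ((hasDerivAt_id u).smul_const t).const_add b
  have h := HasDerivAt.fun_sum (u := Finset.univ) fun k _ =>
    ((hasFDerivAt_score_apply w _ k).comp_hasDerivAt u hline).const_mul (t k)
  simp only [PiLp.inner_apply]
  exact h.congr_deriv (by simp [dotProduct, laplacian_mulVec])

theorem sum_outcomeProb_mul_inner_score :
    ∑ w' ∈ outcomes (comparisonMatrix w), outcomeProb b w' * inner ℝ (score w' b) t = 0 := by
  have h := HasDerivAt.fun_sum (u := outcomes (comparisonMatrix w)) fun w' _ =>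
    hasDerivAt_outcomeProb w' b t 0
  simp only [sum_outcomeProb, zero_smul, add_zero] at h
  exact h.unique (hasDerivAt_const 0 (1 : ℝ))

/-- Bartlett's identity: differentiating twice the fact that the outcome probabilities sum to one
shows that the second moment of the score is the expected negative Hessian of `logLik`, which
depends only on the comparison matrix. -/
theorem sum_outcomeProb_mul_inner_score_sq :
    ∑ w' ∈ outcomes (comparisonMatrix w), outcomeProb b w' * inner ℝ (score w' b) t ^ 2 =
      t.ofLp ⬝ᵥ (laplacian fun i j => (comparisonMatrix w i j : ℝ) * winVar b i j) *ᵥ t.ofLp := by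
  have h := HasDerivAt.fun_sum (u := outcomes (comparisonMatrix w)) fun w' _ =>
    (hasDerivAt_outcomeProb w' b t 0).mul (hasDerivAt_inner_score w' b t 0)
  simp only [Pi.mul_apply, sum_outcomeProb_mul_inner_score] at h
  have h0 := h.unique (hasDerivAt_const 0 (0 : ℝ))
  simp only [zero_smul, add_zero, mul_neg, ← sub_eq_add_neg, Finset.sum_sub_distrib] at h0
  calc ∑ w' ∈ outcomes (comparisonMatrix w), outcomeProb b w' * inner ℝ (score w' b) t ^ 2
      = ∑ w' ∈ outcomes (comparisonMatrix w), outcomeProb b w' *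
          (t.ofLp ⬝ᵥ (laplacian fun i j => (comparisonMatrix w' i j : ℝ) * winVar b i j) *ᵥ
            t.ofLp) := by
        simpa only [sq, mul_assoc] using sub_eq_zero.1 h0
    _ = ∑ w' ∈ outcomes (comparisonMatrix w), outcomeProb b w' *
          (t.ofLp ⬝ᵥ (laplacian fun i j => (comparisonMatrix w i j : ℝ) * winVar b i j) *ᵥ
            t.ofLp) :=
        Finset.sum_congr rfl fun w' hw' => by rw [mem_outcomes.1 hw']
    _ = _ := by rw [← Finset.sum_mul, sum_outcomeProb, one_mul]

end Outcomes

/-! ### Moments of the subjects of a survey -/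

instance {n : ℕ} : DiscreteMeasurableSpace (Matrix (Fin n) (Fin n) ℕ) := ⟨fun _ => trivial⟩

instance {n : ℕ} : Countable (Matrix (Fin n) (Fin n) ℕ) :=
  inferInstanceAs (Countable (Fin n → Fin n → ℕ))

theorem integral_eq_of_forall_setIntegral_fiber_eq {Ω β E : Type*} [MeasurableSpace Ω]
    {μ : Measure Ω} [NormedAddCommGroup E] [NormedSpace ℝ E] [Countable β] [MeasurableSpace β]
    [MeasurableSingletonClass β] {T : Ω → β} (hT : Measurable T) {f g : Ω → E}
    (hf : Integrable f μ) (hg : Integrable g μ)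
    (h : ∀ v, ∫ ω in T ⁻¹' {v}, f ω ∂μ = ∫ ω in T ⁻¹' {v}, g ω ∂μ) :
    ∫ ω, f ω ∂μ = ∫ ω, g ω ∂μ := by
  have hsum {f : Ω → E} (hf : Integrable f μ) :
      HasSum (fun v => ∫ ω in T ⁻¹' {v}, f ω ∂μ) (∫ ω, f ω ∂μ) := by
    have hdisj : Pairwise (Function.onFun Disjoint fun v => T ⁻¹' {v}) := fun v v' hv =>
      Disjoint.preimage _ (by simpa using hv)
    have := hasSum_integral_iUnion (fun v => hT (measurableSet_singleton v)) hdisj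
      (hf.integrableOn (s := ⋃ v, T ⁻¹' {v}))
    rwa [← Set.preimage_iUnion, Set.iUnion_of_singleton, Set.preimage_univ,
      setIntegral_univ] at this
  exact (hsum hf).unique ((funext h : _ = _) ▸ hsum hg)

/-- The mean number of comparisons made by a subject. -/
noncomputable def meanComparisons {n : ℕ} {Ω : Type*} [MeasurableSpace Ω] (μ : Measure Ω)
    (W : ℕ → Ω → Matrix (Fin n) (Fin n) ℕ) : ℝ :=
  ∫ ω, (numComparisons (W 0 ω) : ℝ) ∂μ

namespace IsSurvey

variable {n : ℕ} {Ω : Type*} [MeasurableSpace Ω] {μ : Measure Ω}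
  {W : ℕ → Ω → Matrix (Fin n) (Fin n) ℕ} {P : Matrix (Fin n) (Fin n) ℝ}
  {b : EuclideanSpace ℝ (Fin n)} (hW : IsSurvey μ W P b)
include hW

theorem meanComparisons_pos : 0 < meanComparisons μ W := hW.mean_pos

theorem measurable_comp {β : Type*} [MeasurableSpace β] (s : ℕ)
    (f : Matrix (Fin n) (Fin n) ℕ → β) : Measurable fun ω => f (W s ω) :=
  (measurable_of_countable f).comp (hW.measurable s)

theorem iIndepFun_comp {β : Type*} [MeasurableSpace β] (f : Matrix (Fin n) (Fin n) ℕ → β) :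
    iIndepFun (fun s ω => f (W s ω)) μ :=
  hW.indep.comp (fun _ => f) fun _ => measurable_of_countable f

theorem identDistrib_comp_numComparisons {β : Type*} [MeasurableSpace β] (f : ℕ → β) (s : ℕ) :
    IdentDistrib (fun ω => f (numComparisons (W s ω))) (fun ω => f (numComparisons (W 0 ω))) μ μ :=
  (hW.identDistrib s).comp (measurable_of_countable f)

theorem memLp_comp {E : Type*} [NormedAddCommGroup E] [MeasurableSpace E] [BorelSpace E]
    [SecondCountableTopology E] {f : Matrix (Fin n) (Fin n) ℕ → E} {C : ℝ}
    (hf : ∀ w, (∀ i, w i i = 0) → ‖f w‖ ≤ C * numComparisons w) (s : ℕ) :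
    MemLp (fun ω => f (W s ω)) 2 μ :=
  (((hW.identDistrib_comp_numComparisons Nat.cast s).symm.memLp_snd hW.memLp).const_mul C).mono'
    (hW.measurable_comp s f).aestronglyMeasurable
    (Eventually.of_forall fun ω => hf _ (hW.diag_eq_zero s ω))

theorem memLp_comparisonMatrix (s : ℕ) (i j : Fin n) :
    MemLp (fun ω => (comparisonMatrix (W s ω) i j : ℝ)) 2 μ :=
  hW.memLp_comp (f := fun w => (comparisonMatrix w i j : ℝ)) (C := 1) (fun w hw => by
    simpa using comparisonMatrix_le_numComparisons i j hw) s

theorem memLp_inner_score (s : ℕ) (t : EuclideanSpace ℝ (Fin n)) :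
    MemLp (fun ω => inner ℝ (score (W s ω) b) t) 2 μ :=
  (hW.memLp_comp (f := fun w => score w b) (fun _ => norm_score_le b) s).inner_const t

variable [IsProbabilityMeasure μ]

theorem integral_comparisonMatrix (s : ℕ) (i j : Fin n) :
    ∫ ω, (comparisonMatrix (W s ω) i j : ℝ) ∂μ = meanComparisons μ W * P i j := by
  rw [← integral_condExp (hW.measurable_comp s numComparisons).comap_le,
    integral_congr_ae (hW.condExp_eq s i j), integral_mul_const,
    (hW.identDistrib_comp_numComparisons Nat.cast s).integral_eq, meanComparisons]

theorem freq_comm (i j : Fin n) : P i j = P j i := by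
  refine mul_left_cancel₀ hW.meanComparisons_pos.ne' ?_
  simp only [← hW.integral_comparisonMatrix 0, comparisonMatrix_comm _ i j]

theorem ae_comparisonMatrix_eq_zero (s : ℕ) {i j : Fin n} (hP : P i j = 0) :
    ∀ᵐ ω ∂μ, comparisonMatrix (W s ω) i j = 0 := by
  have h := hW.integral_comparisonMatrix s i j
  rw [hP, mul_zero, integral_eq_zero_iff_of_nonneg (fun ω => Nat.cast_nonneg _)
    ((hW.memLp_comparisonMatrix s i j).integrable one_le_two)] at h
  filter_upwards [h] with ω hω
  exact Nat.cast_eq_zero.1 hω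

theorem setIntegral_comparisonMatrix_eq (s : ℕ) (v : Matrix (Fin n) (Fin n) ℕ)
    (f : Matrix (Fin n) (Fin n) ℕ → ℝ) :
    ∫ ω in (fun ω => comparisonMatrix (W s ω)) ⁻¹' {v}, f (W s ω) ∂μ =
      μ.real {ω | comparisonMatrix (W s ω) = v} * ∑ w ∈ outcomes v, outcomeProb b w * f w := by
  have hset : (fun ω => comparisonMatrix (W s ω)) ⁻¹' {v} = W s ⁻¹' outcomes v := by
    ext ω
    simp
  have : IsProbabilityMeasure (μ.map (W s)) :=
    Measure.isProbabilityMeasure_map (hW.measurable s).aemeasurable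
  rw [hset, ← setIntegral_map MeasurableSet.of_discrete
    (measurable_of_countable f).aestronglyMeasurable (hW.measurable s).aemeasurable,
    setIntegral_finset _ (IntegrableOn.finset), Finset.mul_sum]
  refine Finset.sum_congr rfl fun w hw => ?_
  rw [map_measureReal_apply (hW.measurable s) (measurableSet_singleton w), smul_eq_mul, ← mul_assoc,
    ← mem_outcomes.1 hw]
  exact congrArg (· * f w) (hW.outcome_law s w)

/-- The tower property for the conditional law of the outcomes given the comparison matrix. -/
theorem integral_comp_eq {s : ℕ} {f g : Matrix (Fin n) (Fin n) ℕ → ℝ}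
    (hf : Integrable (fun ω => f (W s ω)) μ)
    (hg : Integrable (fun ω => g (comparisonMatrix (W s ω))) μ)
    (h : ∀ w, ∑ w' ∈ outcomes (comparisonMatrix w), outcomeProb b w' * f w' =
      g (comparisonMatrix w)) :
    ∫ ω, f (W s ω) ∂μ = ∫ ω, g (comparisonMatrix (W s ω)) ∂μ := by
  refine integral_eq_of_forall_setIntegral_fiber_eq (hW.measurable_comp s comparisonMatrix)
    hf hg fun v => ?_
  have hm : MeasurableSet ((fun ω => comparisonMatrix (W s ω)) ⁻¹' {v}) :=
    hW.measurable_comp s comparisonMatrix (measurableSet_singleton v)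
  rcases ((fun ω => comparisonMatrix (W s ω)) ⁻¹' {v}).eq_empty_or_nonempty with hv | ⟨ω, rfl⟩
  · simp [hv]
  · rw [hW.setIntegral_comparisonMatrix_eq, h,
      setIntegral_congr_fun hm (g := fun _ => g (comparisonMatrix (W s ω)))
        fun ω' hω' => congrArg g hω',
      setIntegral_const, smul_eq_mul]
    rfl

theorem integral_inner_score (s : ℕ) (t : EuclideanSpace ℝ (Fin n)) :
    ∫ ω, inner ℝ (score (W s ω) b) t ∂μ = 0 :=
  (hW.integral_comp_eq (f := fun w => inner ℝ (score w b) t) (g := 0)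
    ((hW.memLp_inner_score s t).integrable one_le_two) (integrable_zero _ _ _)
    fun w => sum_outcomeProb_mul_inner_score w b t).trans (integral_zero _ _)

theorem integral_inner_score_sq (s : ℕ) (t : EuclideanSpace ℝ (Fin n)) :
    ∫ ω, inner ℝ (score (W s ω) b) t ^ 2 ∂μ =
      t.ofLp ⬝ᵥ (meanComparisons μ W • fisherInfo P b) *ᵥ t.ofLp := by
  have hint (i j : Fin n) : Integrable (fun ω => (comparisonMatrix (W s ω) i j : ℝ) *
      winVar b i j * (t i - t j) ^ 2) μ :=
    (((hW.memLp_comparisonMatrix s i j).integrable one_le_two).mul_const _).mul_const _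
  have hquad (v : Matrix (Fin n) (Fin n) ℕ) (hv : ∀ i j, v i j = v j i) :
      t.ofLp ⬝ᵥ laplacian (fun i j => (v i j : ℝ) * winVar b i j) *ᵥ t.ofLp = 1 / 2 *
        ∑ i, ∑ j, (v i j : ℝ) * winVar b i j * (t i - t j) ^ 2 :=
    dotProduct_laplacian_mulVec (fun i j => by rw [hv, winVar_comm]) t.ofLp
  rw [hW.integral_comp_eq (f := fun w => inner ℝ (score w b) t ^ 2)
    (g := fun v => 1 / 2 * ∑ i, ∑ j, (v i j : ℝ) * winVar b i j * (t i - t j) ^ 2)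
    (hW.memLp_inner_score s t).integrable_sq
    ((integrable_finsetSum _ fun i _ => integrable_finsetSum _ fun j _ => hint i j).const_mul _)
    fun w => (sum_outcomeProb_mul_inner_score_sq w b t).trans
      (hquad _ (comparisonMatrix_comm w)), integral_const_mul,
    integral_finsetSum _ fun i _ => integrable_finsetSum _ fun j _ => hint i j]
  simp only [integral_finsetSum _ fun j _ => hint _ j, integral_mul_const,
    hW.integral_comparisonMatrix]
  rw [fisherInfo_eq b hW.freq_comm, ← laplacian_smul, dotProduct_laplacian_mulVec fun i j => by
    rw [hW.freq_comm, winVar_comm]]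
  simp only [mul_assoc]

end IsSurvey

/-! ### Pooled data -/

section Pooled

variable {n : ℕ} {Ω : Type*} (W : ℕ → Ω → Matrix (Fin n) (Fin n) ℕ) (S : ℕ) (ω : Ω)

theorem pooled_apply (i j : Fin n) :
    pooled W S ω i j = ∑ s ∈ Finset.range S, W s ω i j :=
  Matrix.sum_apply i j _ _

theorem comparisonMatrix_pooled (i j : Fin n) : comparisonMatrix (pooled W S ω) i j =
    ∑ s ∈ Finset.range S, comparisonMatrix (W s ω) i j := by
  simp only [comparisonMatrix, Matrix.add_apply, Matrix.transpose_apply, pooled_apply,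
    Finset.sum_add_distrib]

theorem numComparisons_pooled :
    numComparisons (pooled W S ω) = ∑ s ∈ Finset.range S, numComparisons (W s ω) := by
  simp only [numComparisons, comparisonMatrix_pooled]
  rw [Finset.sum_comm (s := Finset.range S)]
  exact Finset.sum_congr rfl fun i _ => Finset.sum_comm

theorem score_pooled (b : EuclideanSpace ℝ (Fin n)) :
    score (pooled W S ω) b = ∑ s ∈ Finset.range S, score (W s ω) b := by
  ext k
  simp only [score_apply, WithLp.ofLp_sum, Finset.sum_apply, pooled_apply, comparisonMatrix_pooled,
    Nat.cast_sum, Finset.sum_mul, ← Finset.sum_sub_distrib]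
  exact Finset.sum_comm

end Pooled

namespace IsSurvey

variable {n : ℕ} {Ω : Type*} [MeasurableSpace Ω] {μ : Measure Ω}
  {W : ℕ → Ω → Matrix (Fin n) (Fin n) ℕ} {P : Matrix (Fin n) (Fin n) ℝ}
  {b : EuclideanSpace ℝ (Fin n)} (hW : IsSurvey μ W P b)
include hW

theorem measurable_comp_pooled {β : Type*} [MeasurableSpace β] (S : ℕ)
    (f : Matrix (Fin n) (Fin n) ℕ → β) : Measurable fun ω => f (pooled W S ω) := by
  refine (measurable_of_countable f).comp ?_
  induction S with
  | zero => exact measurable_const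
  | succ S ih =>
    have hsucc : pooled W (S + 1) = fun ω => pooled W S ω + W S ω :=
      funext fun ω => Finset.sum_range_succ _ S
    rw [hsucc]
    exact (measurable_of_countable fun q : Matrix (Fin n) (Fin n) ℕ × Matrix (Fin n) (Fin n) ℕ =>
      q.1 + q.2).comp (ih.prodMk (hW.measurable S))

variable [IsProbabilityMeasure μ]

theorem ae_tendsto_numComparisons :
    ∀ᵐ ω ∂μ, Tendsto (fun S => numComparisons (pooled W S ω)) atTop atTop := by
  filter_upwards [strong_law_ae_real (fun s ω => (numComparisons (W s ω) : ℝ))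
    (hW.memLp.integrable one_le_two)
    (fun i j hij => (hW.iIndepFun_comp fun w => (numComparisons w : ℝ)).indepFun hij)
    (hW.identDistrib_comp_numComparisons Nat.cast)] with ω hω
  refine tendsto_natCast_atTop_iff.1 <|
    (hω.pos_mul_atTop hW.mean_pos tendsto_natCast_atTop_atTop).congr' ?_
  filter_upwards [eventually_ne_atTop 0] with S hS
  rw [div_mul_cancel₀ _ (Nat.cast_ne_zero.2 hS), numComparisons_pooled, Nat.cast_sum]

theorem tendsto_sum_div {f : Matrix (Fin n) (Fin n) ℕ → ℝ} {C m : ℝ}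
    (hf : ∀ w, (∀ i, w i i = 0) → |f w| ≤ C * numComparisons w)
    (hm : ∀ s, ∫ ω, f (W s ω) ∂μ = m) :
    Tendsto (fun x : ℕ × Ω => (∑ s ∈ Finset.range x.1, f (W s x.2)) / x.1)
      (probFilter μ atTop) (𝓝 m) := by
  have h := tendstoInMeasure_sum_div (fun _ _ hst => (hW.iIndepFun_comp f).indepFun hst)
    (fun s => hW.measurable_comp s f) (hW.memLp.const_mul C)
    (hW.identDistrib_comp_numComparisons fun k => C * k)
    (fun s ω => hf _ (hW.diag_eq_zero s ω)) hm
  simpa only [tendstoInMeasure_const_iff] using h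

theorem tendsto_numComparisons_div :
    Tendsto (fun x : ℕ × Ω => (numComparisons (pooled W x.1 x.2) : ℝ) / x.1)
      (probFilter μ atTop) (𝓝 (meanComparisons μ W)) := by
  simpa only [numComparisons_pooled, Nat.cast_sum, meanComparisons] using hW.tendsto_sum_div
    (f := fun w => (numComparisons w : ℝ)) (C := 1)
    (fun w _ => by simp)
    fun s => (hW.identDistrib_comp_numComparisons Nat.cast s).integral_eq

theorem eventually_numComparisons_pos :
    ∀ᶠ x : ℕ × Ω in probFilter μ atTop, 0 < numComparisons (pooled W x.1 x.2) := by
  filter_upwards [hW.tendsto_numComparisons_div.eventually_ne hW.meanComparisons_pos.ne'] with x hx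
  refine Nat.pos_of_ne_zero fun h0 => hx ?_
  rw [h0, Nat.cast_zero, zero_div]

theorem tendsto_sum_div_numComparisons {f : Matrix (Fin n) (Fin n) ℕ → ℝ} {C m : ℝ}
    (hf : ∀ w, (∀ i, w i i = 0) → |f w| ≤ C * numComparisons w)
    (hm : ∀ s, ∫ ω, f (W s ω) ∂μ = meanComparisons μ W * m) :
    Tendsto (fun x : ℕ × Ω => (∑ s ∈ Finset.range x.1, f (W s x.2)) /
      numComparisons (pooled W x.1 x.2)) (probFilter μ atTop) (𝓝 m) := by
  have h := (hW.tendsto_sum_div hf hm).div hW.tendsto_numComparisons_div hW.meanComparisons_pos.ne'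
  rw [mul_div_cancel_left₀ _ hW.meanComparisons_pos.ne'] at h
  refine h.congr' ?_
  filter_upwards [tendsto_fst_probFilter.eventually (eventually_ne_atTop 0)] with x hx
  exact div_div_div_cancel_right₀ (Nat.cast_ne_zero.2 hx) _ _

theorem tendsto_comparisonMatrix_div (i j : Fin n) :
    Tendsto (fun x : ℕ × Ω => (comparisonMatrix (pooled W x.1 x.2) i j : ℝ) /
      numComparisons (pooled W x.1 x.2)) (probFilter μ atTop) (𝓝 (P i j)) := by
  simpa only [comparisonMatrix_pooled, Nat.cast_sum] using hW.tendsto_sum_div_numComparisons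
    (f := fun w => (comparisonMatrix w i j : ℝ)) (C := 1)
    (fun w hw => by simpa using comparisonMatrix_le_numComparisons i j hw)
    fun s => hW.integral_comparisonMatrix s i j

theorem tendsto_inv_smul_score :
    Tendsto (fun x : ℕ × Ω => (numComparisons (pooled W x.1 x.2) : ℝ)⁻¹ •
      score (pooled W x.1 x.2) b) (probFilter μ atTop) (𝓝 0) := by
  have hcoord (k : Fin n) : Tendsto (fun x : ℕ × Ω =>
      ((numComparisons (pooled W x.1 x.2) : ℝ)⁻¹ • score (pooled W x.1 x.2) b) k)
      (probFilter μ atTop) (𝓝 0) := by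
    simp only [score_pooled, PiLp.smul_apply, WithLp.ofLp_sum, Finset.sum_apply, smul_eq_mul,
      inv_mul_eq_div]
    refine hW.tendsto_sum_div_numComparisons (f := fun w => score w b k) (C := 2)
      (fun w hw => (PiLp.norm_apply_le (score w b) k).trans (norm_score_le b hw)) fun s => ?_
    simpa [EuclideanSpace.inner_single_right] using
      hW.integral_inner_score s (EuclideanSpace.single k 1)
  exact ((PiLp.continuous_toLp 2 fun _ : Fin n => ℝ).tendsto _).comp (tendsto_pi_nhds.2 hcoord)

theorem isConnectedWeight_freq (hexists : ∃ S, 0 < μ {ω | ∃! c, IsSumMLE (pooled W S ω) c}) :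
    IsConnectedWeight P := by
  obtain ⟨S, hS⟩ := hexists
  have hae : ∀ᵐ ω ∂μ, ∀ s i j, P i j = 0 → comparisonMatrix (W s ω) i j = 0 := by
    simp only [ae_all_iff]
    exact fun s i j hP => hW.ae_comparisonMatrix_eq_zero s hP
  obtain ⟨ω, hω, hzero⟩ := ((frequently_ae_iff.2 hS.ne').and_eventually hae).exists
  refine (isConnectedWeight_of_existsUnique_isSumMLE hω).mono fun i j => mt fun hP => ?_
  rw [comparisonMatrix_pooled, Finset.sum_eq_zero fun s _ => hzero s i j hP, Nat.cast_zero]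

theorem hasLimitFreq (hexists : ∃ S, 0 < μ {ω | ∃! c, IsSumMLE (pooled W S ω) c}) :
    HasLimitFreq (fun x : ℕ × Ω => pooled W x.1 x.2) P (probFilter μ atTop) where
  eventually_pos := hW.eventually_numComparisons_pos
  tendsto_freq := hW.tendsto_comparisonMatrix_div
  comm := hW.freq_comm
  nonneg i j := (hW.freq_mem i j).1
  connected := hW.isConnectedWeight_freq hexists

end IsSurvey

/-! ### Asymptotic normality -/

theorem map_toEuclideanCLM_multivariateGaussian {ι : Type*} [Fintype ι] [DecidableEq ι]
    {A : Matrix ι ι ℝ} (hA : A.PosSemidef) (B : Matrix ι ι ℝ) :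
    (multivariateGaussian 0 A).map (Matrix.toEuclideanCLM (𝕜 := ℝ) B) =
      multivariateGaussian 0 (B * A * Bᵀ) := by
  refine Measure.ext_of_charFun (funext fun t => ?_)
  have hadj (x : EuclideanSpace ℝ ι) : inner ℝ (Matrix.toEuclideanCLM (𝕜 := ℝ) B x) t =
      inner ℝ x (Matrix.toEuclideanCLM (𝕜 := ℝ) Bᵀ t) := by
    simp only [EuclideanSpace.inner_eq_star_dotProduct, Matrix.ofLp_toEuclideanCLM, star_trivial,
      Matrix.mulVec_transpose, Matrix.dotProduct_mulVec]
  have hBA : (B * A * Bᵀ).PosSemidef := by simpa using hA.mul_mul_conjTranspose_same B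
  calc charFun ((multivariateGaussian 0 A).map (Matrix.toEuclideanCLM (𝕜 := ℝ) B)) t
      = charFun (multivariateGaussian 0 A) (Matrix.toEuclideanCLM (𝕜 := ℝ) Bᵀ t) := by
        rw [charFun_apply, integral_map (by fun_prop) (by fun_prop)]
        simp only [charFun_apply, hadj]
    _ = charFun (multivariateGaussian 0 (B * A * Bᵀ)) t := by
        rw [charFun_multivariateGaussian hA, charFun_multivariateGaussian hBA]
        simp only [inner_zero_right, Matrix.ofLp_toEuclideanCLM]
        rw [Matrix.mulVec_transpose, ← Matrix.dotProduct_mulVec, ← Matrix.mulVec_transpose,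
          Matrix.mulVec_mulVec, Matrix.mulVec_mulVec, Matrix.mul_assoc]

theorem continuous_toEuclideanCLM {ι : Type*} [Fintype ι] [DecidableEq ι] :
    Continuous (Matrix.toEuclideanCLM (𝕜 := ℝ) (n := ι)) :=
  LinearMap.continuous_of_finiteDimensional
    (Matrix.toEuclideanCLM (𝕜 := ℝ) (n := ι)).toAlgEquiv.toLinearMap

theorem tendstoInDistribution_of_eventuallyEq_probFilter {Ω Ω' E : Type*} [MeasurableSpace Ω]
    [MeasurableSpace Ω'] {μ : Measure Ω} [IsProbabilityMeasure μ] {ν : Measure Ω'}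
    [IsProbabilityMeasure ν] [NormedAddCommGroup E] [MeasurableSpace E] [BorelSpace E]
    [SecondCountableTopology E] {X Y : ℕ → Ω → E} {Z : Ω' → E}
    (hX : TendstoInDistribution X atTop Z (fun _ => μ) ν) (hY : ∀ S, AEMeasurable (Y S) μ)
    (hXY : ∀ᶠ x : ℕ × Ω in probFilter μ atTop, X x.1 x.2 = Y x.1 x.2) :
    TendstoInDistribution Y atTop Z (fun _ => μ) ν := by
  refine tendstoInDistribution_of_tendstoInMeasure_sub Y Z hX ?_ hY
  rw [show (0 : Ω → E) = fun _ => 0 from rfl, tendstoInMeasure_const_iff]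
  refine tendsto_const_nhds.congr' (hXY.mono fun x hx => ?_)
  simp [hx]

theorem tendstoInDistribution_of_identDistrib_limit {Ω Ω' Ω'' E : Type*} [MeasurableSpace Ω]
    [MeasurableSpace Ω'] [MeasurableSpace Ω''] {μ : Measure Ω} [IsProbabilityMeasure μ]
    {ν : Measure Ω'} [IsProbabilityMeasure ν] {ν' : Measure Ω''} [IsProbabilityMeasure ν']
    [TopologicalSpace E] [MeasurableSpace E] [OpensMeasurableSpace E] {X : ℕ → Ω → E} {Z : Ω' → E}
    {Z' : Ω'' → E} (hX : TendstoInDistribution X atTop Z (fun _ => μ) ν)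
    (hZ : IdentDistrib Z Z' ν ν') : TendstoInDistribution X atTop Z' (fun _ => μ) ν' where
  forall_aemeasurable := hX.forall_aemeasurable
  aemeasurable_limit := hZ.aemeasurable_snd
  tendsto := by simpa only [hZ.map_eq] using hX.tendsto

namespace IsSurvey

variable {n : ℕ} {Ω : Type*} [MeasurableSpace Ω] {μ : Measure Ω} [IsProbabilityMeasure μ]
  {W : ℕ → Ω → Matrix (Fin n) (Fin n) ℕ} {P : Matrix (Fin n) (Fin n) ℝ}
  {b : EuclideanSpace ℝ (Fin n)} (hW : IsSurvey μ W P b)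
include hW

theorem fisherInfo_posSemidef : (fisherInfo P b).PosSemidef := by
  rw [fisherInfo_eq b hW.freq_comm]
  exact laplacian_posSemidef (fun i j => by rw [hW.freq_comm, winVar_comm])
    fun i j => mul_nonneg (hW.freq_mem i j).1 (winVar_pos b i j).le

theorem tendstoInDistribution_score :
    TendstoInDistribution (fun (S : ℕ) ω => (√S)⁻¹ • score (pooled W S ω) b) atTop id (fun _ => μ)
      (multivariateGaussian 0 (meanComparisons μ W • fisherInfo P b)) := by
  simp only [score_pooled]
  exact tendstoInDistribution_inv_sqrt_smul_sum (Y := fun s ω => 2 * numComparisons (W s ω))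
    (hW.iIndepFun_comp fun w => score w b) (fun s => hW.measurable_comp s fun w => score w b)
    (hW.memLp.const_mul 2) (hW.identDistrib_comp_numComparisons fun k => 2 * (k : ℝ))
    (fun s ω => norm_score_le b (hW.diag_eq_zero s ω)) hW.integral_inner_score
    (hW.fisherInfo_posSemidef.smul hW.meanComparisons_pos.le) hW.integral_inner_score_sq

theorem tendsto_errorMatrix_div (hb : ∑ i, b i = 0)
    (hexists : ∃ S, 0 < μ {ω | ∃! c, IsSumMLE (pooled W S ω) c})
    {βhat : Matrix (Fin n) (Fin n) ℕ → EuclideanSpace ℝ (Fin n)}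
    (hβhat : ∀ w : Matrix (Fin n) (Fin n) ℕ, (∃! c, IsSumMLE w c) → IsSumMLE w (βhat w)) :
    Tendsto (fun x : ℕ × Ω => (√((numComparisons (pooled W x.1 x.2) : ℝ) / x.1))⁻¹ •
        errorMatrix (pooled W x.1 x.2) b (βhat (pooled W x.1 x.2))) (probFilter μ atTop)
      (𝓝 ((√(meanComparisons μ W))⁻¹ • pseudoinverse (fisherInfo P b))) := by
  have hfreq := hW.hasLimitFreq hexists
  have hM := hfreq.tendsto_errorMatrix (hfreq.tendsto_estimator hb hW.tendsto_inv_smul_score hβhat)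
  rw [← fisherInfo_eq b hW.freq_comm] at hM
  exact (hW.tendsto_numComparisons_div.sqrt.inv₀
    (Real.sqrt_ne_zero'.2 hW.meanComparisons_pos)).smul hM

theorem eventually_sqrt_smul_estimator_sub (hb : ∑ i, b i = 0)
    (hexists : ∃ S, 0 < μ {ω | ∃! c, IsSumMLE (pooled W S ω) c})
    {βhat : Matrix (Fin n) (Fin n) ℕ → EuclideanSpace ℝ (Fin n)}
    (hβhat : ∀ w : Matrix (Fin n) (Fin n) ℕ, (∃! c, IsSumMLE w c) → IsSumMLE w (βhat w)) :
    ∀ᶠ x : ℕ × Ω in probFilter μ atTop,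
      Matrix.toEuclideanCLM (𝕜 := ℝ) ((√((numComparisons (pooled W x.1 x.2) : ℝ) / x.1))⁻¹ •
        errorMatrix (pooled W x.1 x.2) b (βhat (pooled W x.1 x.2)))
          ((√x.1)⁻¹ • score (pooled W x.1 x.2) b) =
        √(numComparisons (pooled W x.1 x.2) : ℝ) • (βhat (pooled W x.1 x.2) - b) := by
  have hfreq := hW.hasLimitFreq hexists
  filter_upwards [tendsto_fst_probFilter.eventually (eventually_gt_atTop 0), hfreq.eventually_pos,
    hfreq.eventually_isConnectedWeight,
    hfreq.eventually_isSumMLE hb hW.tendsto_inv_smul_score hβhat] with x hS hN hconn hmle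
  have hS' : √(x.1 : ℝ) ≠ 0 := Real.sqrt_ne_zero'.2 (Nat.cast_pos.2 hS)
  have hN' : √(numComparisons (pooled W x.1 x.2) : ℝ) ≠ 0 :=
    Real.sqrt_ne_zero'.2 (Nat.cast_pos.2 hN)
  rw [map_smul, map_smul, smul_apply,
    ← hmle.numComparisons_smul_sub hb hN hconn, smul_smul, smul_smul,
    Real.sqrt_div' _ (Nat.cast_nonneg _)]
  congr 1
  field_simp
  exact (Real.sq_sqrt (Nat.cast_nonneg _)).symm

theorem map_pseudoinverse_fisherInfo_multivariateGaussian :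
    (multivariateGaussian 0 (meanComparisons μ W • fisherInfo P b)).map
        (Matrix.toEuclideanCLM (𝕜 := ℝ)
          ((√(meanComparisons μ W))⁻¹ • pseudoinverse (fisherInfo P b))) =
      multivariateGaussian 0 (pseudoinverse (fisherInfo P b)) := by
  have hκ := hW.meanComparisons_pos
  have hI : (fisherInfo P b).IsSymm := by simpa using hW.fisherInfo_posSemidef.isHermitian
  have hscale : (√(meanComparisons μ W))⁻¹ * (meanComparisons μ W * (√(meanComparisons μ W))⁻¹) =
      1 := by
    rw [mul_left_comm, ← mul_inv, Real.mul_self_sqrt hκ.le, mul_inv_cancel₀ hκ.ne']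
  rw [map_toEuclideanCLM_multivariateGaussian (hW.fisherInfo_posSemidef.smul hκ.le)]
  simp only [Matrix.transpose_smul, (pseudoinverse_isSymm hI).eq, Matrix.smul_mul,
    Matrix.mul_smul, smul_smul, hscale, one_smul,
    (isPseudoinverse_pseudoinverse (fisherInfo P b)).mul_mul_right]

theorem tendstoInDistribution_estimator (hb : ∑ i, b i = 0)
    (hexists : ∃ S, 0 < μ {ω | ∃! c, IsSumMLE (pooled W S ω) c})
    {βhat : Matrix (Fin n) (Fin n) ℕ → EuclideanSpace ℝ (Fin n)}
    (hβhat : ∀ w : Matrix (Fin n) (Fin n) ℕ, (∃! c, IsSumMLE w c) → IsSumMLE w (βhat w)) :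
    TendstoInDistribution
      (fun (S : ℕ) ω => √(numComparisons (pooled W S ω) : ℝ) • (βhat (pooled W S ω) - b))
      atTop id (fun _ => μ) (multivariateGaussian 0 (pseudoinverse (fisherInfo P b))) := by
  have hT : TendstoInMeasure μ (fun (S : ℕ) ω => Matrix.toEuclideanCLM (𝕜 := ℝ)
      ((√((numComparisons (pooled W S ω) : ℝ) / S))⁻¹ •
        errorMatrix (pooled W S ω) b (βhat (pooled W S ω)))) atTop
      fun _ => Matrix.toEuclideanCLM (𝕜 := ℝ)
        ((√(meanComparisons μ W))⁻¹ • pseudoinverse (fisherInfo P b)) := by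
    rw [tendstoInMeasure_const_iff]
    exact (continuous_toEuclideanCLM.tendsto _).comp (hW.tendsto_errorMatrix_div hb hexists hβhat)
  have hslutsky := hW.tendstoInDistribution_score.continuous_comp_prodMk_of_tendstoInMeasure_const
    (g := fun q : EuclideanSpace ℝ (Fin n) × (EuclideanSpace ℝ (Fin n) →L[ℝ]
      EuclideanSpace ℝ (Fin n)) => q.2 q.1) (by fun_prop) hT
    fun S => (hW.measurable_comp_pooled S fun w => Matrix.toEuclideanCLM (𝕜 := ℝ)
      ((√((numComparisons w : ℝ) / S))⁻¹ • errorMatrix w b (βhat w))).aemeasurable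
  refine tendstoInDistribution_of_eventuallyEq_probFilter
    (tendstoInDistribution_of_identDistrib_limit hslutsky ⟨by fun_prop, aemeasurable_id, ?_⟩)
    (fun S => (hW.measurable_comp_pooled S fun w =>
      √(numComparisons w : ℝ) • (βhat w - b)).aemeasurable)
    (hW.eventually_sqrt_smul_estimator_sub hb hexists hβhat)
  rw [Measure.map_id]
  exact hW.map_pseudoinverse_fisherInfo_multivariateGaussian

end IsSurvey

theorem theorem3p5 {n : ℕ} {Ω : Type*} [MeasurableSpace Ω]
    (μ : Measure Ω) [IsProbabilityMeasure μ]
    (W : ℕ → Ω → Matrix (Fin n) (Fin n) ℕ) (P : Matrix (Fin n) (Fin n) ℝ)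
    (βstar : EuclideanSpace ℝ (Fin n)) (hβstar : ∑ i, βstar i = 0)
    (hW : IsSurvey μ W P βstar)
    -- the MLE exists and is unique, with positive probability for some number of subjects
    (hexists : ∃ S, 0 < μ {ω | ∃! b, IsSumMLE (pooled W S ω) b})
    -- `βhat` is the MLE whenever the MLE exists and is unique
    (βhat : Matrix (Fin n) (Fin n) ℕ → EuclideanSpace ℝ (Fin n))
    (hβhat : ∀ w : Matrix (Fin n) (Fin n) ℕ, (∃! b, IsSumMLE w b) → IsSumMLE w (βhat w)) :
    (∀ᵐ ω ∂μ, Tendsto (fun S => numComparisons (pooled W S ω)) atTop atTop) ∧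
    TendstoInDistribution
      (fun (S : ℕ) ω => √(numComparisons (pooled W S ω) : ℝ) •
        (βhat (pooled W S ω) - βstar))
      atTop id (fun _ => μ)
      (multivariateGaussian 0 (pseudoinverse (fisherInfo P βstar))) ∧
    ∀ i j, TendstoInMeasure μ
      (fun (S : ℕ) ω => (numComparisons (pooled W S ω) : ℝ) *
        (-pseudoinverse (hessian (pooled W S ω) (βhat (pooled W S ω)))) i j)
      atTop (fun _ => pseudoinverse (fisherInfo P βstar) i j) := by
  have hfreq := hW.hasLimitFreq hexists
  refine ⟨hW.ae_tendsto_numComparisons,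
    hW.tendstoInDistribution_estimator hβstar hexists hβhat, fun i j => ?_⟩
  have hconsistent := hfreq.tendsto_estimator hβstar hW.tendsto_inv_smul_score hβhat
  have hvariance := hfreq.tendsto_neg_pseudoinverse_hessian hconsistent
  rw [← fisherInfo_eq βstar hW.freq_comm] at hvariance
  rw [tendstoInMeasure_const_iff]
  exact ((continuous_id.matrix_elem i j).tendsto _).comp hvariance
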